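/- Let $n\ge 1$ and $\lambda\in\mathbb{R}$. A *closed $\lambda$-self-expander* in $\mathbb{R}^{n+1}$ is a smooth immersion $x:\Sigma\to\mathbb{R}^{n+1}$ of a compact connected $n$-dimensional manifold $\Sigma$ without boundary, together with a smooth outward unit normal field $\mathbf n$, such that $$H=-\frac{\langle x,\mathbf n\rangle}{2}+\lambda\quad\text{on }\Sigma .$$ Here $A(X)=-\bar\nabla_X\mathbf n$ is the second fundamental form, $|A|$ its norm in the induced metric, and $H=-\operatorname{tr}A$, so that $H=n/r$ for a sphere of radius $r$ with its outward normal. Outward means that at some point of $\Sigma$ at maximal distance from the origin, $\mathbf n$ is a positive multiple of $x$; for an embedded $\Sigma$ the usual outward normal has this property, and for any unit normal field $\mathbf n$ on a closed immersed hypersurface $\mathbf n$ or $-\mathbf n$ has it. Write $\mathbb{S}^n_r(0)$ for the sphere of radius $r$ about the origin; "$\Sigma$ is the sphere $\mathbb{S}^n_r(0)$" means that $x(\Sigma)=\mathbb{S}^n_r(0)$ and, if $n\ge 2$, that $x$ is also injective (if $n=1$ the curve may run several times around the circle). **Theorem.** Let $\Sigma$ be a closed $\lambda$-self-expander immersed in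 $\mathbb{R}^{n+1}$. Then: (i) $\lambda\ge\sqrt{2n}$. Moreover, the sphere $\mathbb{S}^n_{\sqrt{2n}}(0)$ is a closed $\lambda$-self-expander with $\lambda=\sqrt{2n}$, and it is the only one: if $\lambda=\sqrt{2n}$, then $\Sigma$ is the sphere $\mathbb{S}^n_{\sqrt{2n}}(0)$. (ii) If $$|A|^2\le-\frac12+\frac{\lambda\left(\lambda-\sqrt{\lambda^2-2n}\right)}{2n}\quad\text{on }\Sigma,$$ then $\Sigma$ is the sphere $\mathbb{S}^n_r(0)$ with $r=\lambda+\sqrt{\lambda^2-2n}$. -/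

import Mathlib

open scoped Manifold ContDiff RealInnerProductSpace Matrix

noncomputable section

namespace LambdaExpander

/-- The Euclidean space `ℝᵈ`. -/
abbrev Eucl (d : ℕ) : Type := EuclideanSpace ℝ (Fin d)

section Hypersurface

variable {n : ℕ} {M : Type*} [TopologicalSpace M] [ChartedSpace (Eucl n) M]

/-- The derivative at `p` of a map `F : M → ℝⁿ⁺¹` in the direction of the `i`-th vector of the
coordinate basis of `T_p M`. -/
def partialAt (F : M → Eucl (n + 1)) (p : M) (i : Fin n) : Eucl (n + 1) :=
  (mfderiv (𝓡 n) 𝓘(ℝ, Eucl (n + 1)) F p : Eucl n →L[ℝ] Eucl (n + 1))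
    (EuclideanSpace.single i (1 : ℝ))

/-- The induced metric `g_{ij} = ⟨∂_i f, ∂_j f⟩` at `p`. -/
def gram (f : M → Eucl (n + 1)) (p : M) : Matrix (Fin n) (Fin n) ℝ :=
  Matrix.of fun i j => ⟪partialAt f p i, partialAt f p j⟫

/-- The second fundamental form `h_{ij} = ⟨A(∂_i), ∂_j f⟩ = -⟨∂_i N, ∂_j f⟩` at `p` of the
hypersurface `f` with unit normal field `N`; here `A(X) = -D_X N`. -/
def secondFF (f N : M → Eucl (n + 1)) (p : M) : Matrix (Fin n) (Fin n) ℝ :=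
  Matrix.of fun i j => -⟪partialAt N p i, partialAt f p j⟫

/-- The mean curvature `H = -tr_g h = -∑ g^{ij} h_{ij}`, the trace of `-A`; it is `n / r` for the
sphere of radius `r` with its outward normal. -/
def meanCurvature (f N : M → Eucl (n + 1)) (p : M) : ℝ :=
  -((gram f p)⁻¹ * secondFF f N p).trace

/-- `|A|² = ∑ g^{ik} g^{jl} h_{ij} h_{kl}`, the squared norm of the second fundamental form with
respect to the induced metric. -/
def normSqA (f N : M → Eucl (n + 1)) (p : M) : ℝ :=
  ((gram f p)⁻¹ * secondFF f N p * (gram f p)⁻¹ * (secondFF f N p)ᵀ).trace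

/-- `f : M → ℝⁿ⁺¹` is a smoothly immersed hypersurface with smooth unit normal field `N`. -/
structure IsImmersedHypersurface (f N : M → Eucl (n + 1)) : Prop where
  smooth : ContMDiff (𝓡 n) 𝓘(ℝ, Eucl (n + 1)) ∞ f
  immersion : ∀ p, Function.Injective (mfderiv (𝓡 n) 𝓘(ℝ, Eucl (n + 1)) f p)
  smooth_normal : ContMDiff (𝓡 n) 𝓘(ℝ, Eucl (n + 1)) ∞ N
  norm_normal : ∀ p, ‖N p‖ = 1
  normal : ∀ p i, ⟪N p, partialAt f p i⟫ = 0

/-- The choice of sign of the unit normal field `N` of a compact immersed hypersurface: at some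
point at maximal distance from the origin, `N` points away from the origin. (At such a point the
normal line is spanned by the position vector.)
For an embedded hypersurface this is implied by pointing into the unbounded component of the
complement; on any compact immersed hypersurface at least one of `N`, `-N` is outward. -/
def IsOutward (f N : M → Eucl (n + 1)) : Prop :=
  ∃ p, (∀ q, ‖f q‖ ≤ ‖f p‖) ∧ 0 < ⟪f p, N p⟫

/-- `f : M → ℝⁿ⁺¹`, with outward unit normal field `N`, is a closed (compact, connected, without
boundary) immersed `lam`-self-expander: `H = -⟨x, N⟩ / 2 + lam`. -/
structure IsClosedSelfExpander (f N : M → Eucl (n + 1)) (lam : ℝ) : Prop where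
  manifold : IsManifold (𝓡 n) ∞ M
  t2 : T2Space M
  compact : CompactSpace M
  connected : ConnectedSpace M
  hypersurface : IsImmersedHypersurface f N
  outward : IsOutward f N
  expander : ∀ p, meanCurvature f N p = -⟪f p, N p⟫ / 2 + lam

/-- The immersed hypersurface `f` is the sphere of radius `r` about the origin: its image is the
sphere and, in dimension at least two, `f` is one-to-one (a closed curve may run several times
around a circle). -/
def IsRoundSphere (f : M → Eucl (n + 1)) (r : ℝ) : Prop :=
  Set.range f = Metric.sphere (0 : Eucl (n + 1)) r ∧ (2 ≤ n → Function.Injective f)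

end Hypersurface

/-- The sphere of radius `r` about the origin, parametrized by the unit sphere. -/
def sphereMap (n : ℕ) (r : ℝ) : Metric.sphere (0 : Eucl (n + 1)) 1 → Eucl (n + 1) :=
  fun x => r • (x : Eucl (n + 1))

/-- The radial unit normal field of the sphere. -/
def sphereNormal (n : ℕ) : Metric.sphere (0 : Eucl (n + 1)) 1 → Eucl (n + 1) :=
  fun x => (x : Eucl (n + 1))

end LambdaExpander

end

/-! Write `s = ⟨x, N⟩`. The Gauss formula gives `Δ(|x|²/2) = n - H s`. At a point where `|x|` is
maximal, equal to `ρ`, the position vector is normal, so `s = ρ` by the outward choice of sign, and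
the Laplacian is nonpositive. Hence `Hρ ≥ n`, and the equation for `H` turns this into `n/ρ + ρ/2 ≤
λ`. Everything starts from this inequality (`exists_max`).

The AM-GM inequality gives `λ ≥ √(2n)`. If equality holds, then `ρ = √(2n)`, and everywhere `n - H s
= (s - √(2n))²/2 ≥ 0`. Thus `|x|²` is subharmonic and, by Hopf's strong maximum principle, constant.

In the gap theorem put `r = λ + √(λ² - 2n)`, the larger root of `ρ² - 2λρ + 2n`. The inequality
above gives `|x| ≤ ρ ≤ r`. The curvature bound is exactly `|A|² ≤ n/r²`, so `H² ≤ n|A|²` yields `H ≤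
n/r`, that is `s ≥ r`. Since `s ≤ |x|`, again `|x|` is constant; no maximum principle is needed
beyond the one at the farthest point.

Finally, a closed immersed hypersurface with `|x| = r` covers the sphere. For `n ≥ 2` the covering
is one-to-one, because the sphere is simply connected; a circle has multiple coverings. -/

noncomputable section

namespace LambdaExpander

open Filter Topology Matrix

/-! ### Second derivatives at a maximum. -/

section SecondOrder

variable {V : Type*} [NormedAddCommGroup V] [NormedSpace ℝ V]

/-- The second derivative is nonpositive at an interior maximum. -/
theorem snd_fderiv_nonpos_of_isLocalMax {v : V → ℝ} {y : V} (hv : ContDiffAt ℝ 2 v y)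
    (hmax : IsLocalMax v y) (w : V) : fderiv ℝ (fderiv ℝ v) y w w ≤ 0 := by
  by_contra! hpos
  set c : ℝ → V := fun t => y + t • w with hc
  have hc0 : c 0 = y := by simp [hc]
  have hcd : ∀ t, HasDerivAt c w t := fun t => by
    simpa [hc] using ((hasDerivAt_id t).smul_const w).const_add y
  have hcc : ContinuousAt c 0 := (hcd 0).continuousAt
  have hev : ∀ᶠ t in 𝓝 (0 : ℝ), DifferentiableAt ℝ v (c t) := by
    have : ∀ᶠ z in 𝓝 y, ContDiffAt ℝ 2 v z := hv.eventually (by simp)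
    have := hcc.eventually (by rwa [hc0] : ∀ᶠ z in 𝓝 (c 0), ContDiffAt ℝ 2 v z)
    exact this.mono fun t ht => ht.differentiableAt (by simp)
  have h1 : deriv (fun t => v (c t)) =ᶠ[𝓝 0] fun t => fderiv ℝ v (c t) w :=
    hev.mono fun t ht => (ht.hasFDerivAt.comp_hasDerivAt t (hcd t)).deriv
  have hd2 : DifferentiableAt ℝ (fderiv ℝ v) y :=
    (hv.fderiv_right (m := 1) (by norm_num)).differentiableAt (by simp)
  have h2 : HasDerivAt (fun t => fderiv ℝ v (c t) w) (fderiv ℝ (fderiv ℝ v) y w w) 0 := by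
    have := (hc0.symm ▸ hd2 : DifferentiableAt ℝ (fderiv ℝ v) (c 0)).hasFDerivAt.comp_hasDerivAt
      0 (hcd 0)
    have := this.clm_apply (hasDerivAt_const (0 : ℝ) w)
    simpa [hc0] using this
  have h3 : deriv (deriv (fun t => v (c t))) 0 = fderiv ℝ (fderiv ℝ v) y w w :=
    h1.deriv_eq.trans h2.deriv
  have hloc : IsLocalMax (fun t => v (c t)) 0 :=
    (show IsLocalMax v (c 0) by rwa [hc0]).comp_continuous hcc
  -- If the second derivative along the line were positive, `0` would be a local minimum as well;
  -- then `v` is constant along the line near `0`, and the second derivative vanishes.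
  have hmin : IsLocalMin (fun t => v (c t)) 0 :=
    isLocalMin_of_deriv_deriv_pos (h3 ▸ hpos) hloc.deriv_eq_zero
      (hev.self_of_nhds.continuousAt.comp hcc)
  have heq : (fun t => v (c t)) =ᶠ[𝓝 0] fun _ => v (c 0) := by
    filter_upwards [hloc, hmin] with t h h' using le_antisymm h h'
  have : deriv (deriv (fun t => v (c t))) 0 = 0 := by
    rw [heq.deriv.deriv_eq]; simp
  rw [← h3, this] at hpos
  exact lt_irrefl _ hpos

end SecondOrder

/-! ### Matrix inequalities. -/

section Algebra

variable {n : ℕ}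

/-- A positive semidefinite matrix is of the form `Pᵀ P`. -/
theorem exists_transpose_mul_self {A : Matrix (Fin n) (Fin n) ℝ} (hA : A.PosSemidef) :
    ∃ P : Matrix (Fin n) (Fin n) ℝ, A = Pᵀ * P := by
  open scoped MatrixOrder in
  obtain ⟨P, hP⟩ := CStarAlgebra.nonneg_iff_eq_star_mul_self.mp hA.nonneg
  exact ⟨P, by simpa [Matrix.star_eq_conjTranspose] using hP⟩

/-- With `A = Pᵀ P`, the contraction is the sum of the values of `B` on the diagonal at the rows of
`P`. -/
theorem sum_mul_bilin_nonpos {A : Matrix (Fin n) (Fin n) ℝ} (hA : A.PosSemidef)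
    (B : Eucl n →L[ℝ] Eucl n →L[ℝ] ℝ) (hB : ∀ w, B w w ≤ 0) :
    ∑ i, ∑ j, A i j * B (EuclideanSpace.single i 1) (EuclideanSpace.single j 1) ≤ 0 := by
  obtain ⟨P, rfl⟩ := exists_transpose_mul_self hA
  have : ∑ i, ∑ j, (Pᵀ * P) i j * B (EuclideanSpace.single i 1) (EuclideanSpace.single j 1)
      = ∑ k, B (∑ i, P k i • EuclideanSpace.single i 1) (∑ i, P k i • EuclideanSpace.single i 1) := by
    simp only [map_sum, map_smul, _root_.sum_apply, _root_.smul_apply,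
      Matrix.mul_apply, Matrix.transpose_apply, smul_eq_mul, Finset.sum_mul, Finset.mul_sum]
    rw [Finset.sum_congr rfl fun i _ => Finset.sum_comm, Finset.sum_comm]
    refine Finset.sum_congr rfl fun k _ => ?_
    rw [Finset.sum_comm]
    refine Finset.sum_congr rfl fun i _ => Finset.sum_congr rfl fun j _ => by ring
  rw [this]
  exact Finset.sum_nonpos fun k _ => hB _

/-- With `A = Pᵀ P` and `B = P S Pᵀ` this is `(tr B)² ≤ n tr(B Bᵀ)`: Cauchy–Schwarz on the diagonal,
then the off-diagonal squares are added. For `A = g⁻¹` and `S = h` it becomes `H² ≤ n|A|²`. -/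
theorem trace_sq_le_of_posSemidef {A : Matrix (Fin n) (Fin n) ℝ} (hA : A.PosSemidef)
    (S : Matrix (Fin n) (Fin n) ℝ) :
    (A * S).trace ^ 2 ≤ n * (A * S * A * Sᵀ).trace := by
  obtain ⟨P, rfl⟩ := exists_transpose_mul_self hA
  set B := P * S * Pᵀ with hB
  have h1 : (Pᵀ * P * S).trace = B.trace := by
    rw [hB, Matrix.mul_assoc, Matrix.trace_mul_comm]
  have h2 : (Pᵀ * P * S * (Pᵀ * P) * Sᵀ).trace = (B * Bᵀ).trace := by
    rw [hB, Matrix.transpose_mul, Matrix.transpose_mul, Matrix.transpose_transpose]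
    simp only [Matrix.mul_assoc]
    rw [Matrix.trace_mul_comm]
    simp only [Matrix.mul_assoc]
  rw [h1, h2]
  calc B.trace ^ 2 = (∑ i, B i i) ^ 2 := rfl
    _ ≤ n * ∑ i, B i i ^ 2 := by
      simpa using sq_sum_le_card_mul_sum_sq (s := Finset.univ) (f := fun i => B i i)
    _ ≤ n * (B * Bᵀ).trace := by
      gcongr
      refine Finset.sum_le_sum fun i _ => ?_
      simp only [Matrix.diag_apply, Matrix.mul_apply, Matrix.transpose_apply, ← sq]
      exact Finset.single_le_sum (f := fun j => B i j ^ 2) (fun j _ => sq_nonneg _)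
        (Finset.mem_univ i)

end Algebra

/-! ### Hopf's strong maximum principle. -/

section MaximumPrinciple

variable {n : ℕ}

/-- The second order differential operator `v ↦ ∑ Aᵢⱼ ∂ᵢ∂ⱼ v + b · ∇v`. -/
def secondOrderOp (A : Eucl n → Matrix (Fin n) (Fin n) ℝ) (b : Eucl n → Eucl n) (v : Eucl n → ℝ)
    (y : Eucl n) : ℝ :=
  ∑ i, ∑ j, A y i j * fderiv ℝ (fderiv ℝ v) y (EuclideanSpace.single i 1)
    (EuclideanSpace.single j 1) + fderiv ℝ v y (b y)

variable {A : Eucl n → Matrix (Fin n) (Fin n) ℝ} {b : Eucl n → Eucl n}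

theorem secondOrderOp_nonpos_of_isLocalMax {v : Eucl n → ℝ} {y : Eucl n} (hA : (A y).PosSemidef)
    (hv : ContDiffAt ℝ 2 v y) (hmax : IsLocalMax v y) : secondOrderOp A b v y ≤ 0 := by
  rw [secondOrderOp, hmax.fderiv_eq_zero]
  simpa using sum_mul_bilin_nonpos hA _ (snd_fderiv_nonpos_of_isLocalMax hv hmax)

theorem secondOrderOp_add_const_mul {v h : Eucl n → ℝ} {y : Eucl n} (hv : ContDiffAt ℝ 2 v y)
    (hh : ContDiffAt ℝ 2 h y) (ε : ℝ) :
    secondOrderOp A b (fun y => v y + ε * h y) y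
      = secondOrderOp A b v y + ε * secondOrderOp A b h y := by
  have hd : ∀ {u : Eucl n → ℝ}, ContDiffAt ℝ 2 u y → ∀ᶠ z in 𝓝 y, DifferentiableAt ℝ u z :=
    fun hu => (hu.eventually (by simp)).mono fun z hz => hz.differentiableAt (by simp)
  have hd2 : ∀ {u : Eucl n → ℝ}, ContDiffAt ℝ 2 u y → DifferentiableAt ℝ (fderiv ℝ u) y :=
    fun hu => (hu.fderiv_right (m := 1) (by norm_num)).differentiableAt (by simp)
  have h1 : fderiv ℝ (fun y => v y + ε * h y) =ᶠ[𝓝 y] fun z => fderiv ℝ v z + ε • fderiv ℝ h z := by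
    filter_upwards [hd hv, hd hh] with z h1 h2
    exact (h1.hasFDerivAt.add (h2.hasFDerivAt.const_mul ε)).fderiv
  have h2 : fderiv ℝ (fderiv ℝ (fun y => v y + ε * h y)) y
      = fderiv ℝ (fderiv ℝ v) y + ε • fderiv ℝ (fderiv ℝ h) y := by
    rw [h1.fderiv_eq]
    exact ((hd2 hv).hasFDerivAt.add ((hd2 hh).hasFDerivAt.const_smul ε)).fderiv
  simp only [secondOrderOp, h2, h1.self_of_nhds, _root_.add_apply, _root_.smul_apply, smul_eq_mul,
    mul_add, Finset.sum_add_distrib, Finset.mul_sum]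
  simp only [mul_left_comm ε]
  ring

section Barrier

variable {V : Type*} [NormedAddCommGroup V] [InnerProductSpace ℝ V]

/-- The barrier at a boundary point `p` of a ball centred at `p - z`. -/
def barrier (p z : V) (α : ℝ) (y : V) : ℝ :=
  -2 * ⟪z, y - p⟫ - 2 * ⟪y - p, y - p⟫ + α * ⟪z, y - p⟫ ^ 2

theorem contDiff_barrier (p z : V) (α : ℝ) : ContDiff ℝ 2 (barrier p z α) := by
  have h0 : ContDiff ℝ 2 (fun y : V => y - p) := contDiff_id.sub contDiff_const
  have h1 : ContDiff ℝ 2 (fun y : V => ⟪z, y - p⟫) := contDiff_const.inner ℝ h0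
  exact ((contDiff_const.mul h1).sub (contDiff_const.mul (h0.inner ℝ h0))).add
    (contDiff_const.mul (h1.pow 2))

theorem fderiv_barrier (p z : V) (α : ℝ) : fderiv ℝ (barrier p z α) = fun y =>
    (-2 : ℝ) • innerSL ℝ z - (4 : ℝ) • innerSL ℝ (y - p)
      + (2 * α * innerSL ℝ z (y - p)) • innerSL ℝ z := by
  ext y w
  have h0 : HasFDerivAt (fun y : V => y - p) (ContinuousLinearMap.id ℝ V) y :=
    (hasFDerivAt_id y).sub_const p
  have h1 : HasFDerivAt (fun y : V => ⟪z, y - p⟫) (innerSL ℝ z) y :=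
    (innerSL ℝ z).hasFDerivAt.comp y h0
  have h := ((h1.const_mul (-2)).sub ((h0.inner ℝ h0).const_mul 2)).add ((h1.pow 2).const_mul α)
  have h' : fderiv ℝ (barrier p z α) y = _ := h.fderiv
  rw [h']
  have hw : ⟪w, y - p⟫ = ⟪y - p, w⟫ := real_inner_comm _ _
  simp [hw]
  rw [inner_sub_left]
  ring

theorem snd_fderiv_barrier (p z : V) (α : ℝ) (y w w' : V) :
    fderiv ℝ (fderiv ℝ (barrier p z α)) y w w' = -4 * ⟪w, w'⟫ + 2 * α * ⟪z, w⟫ * ⟪z, w'⟫ := by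
  have h0 : HasFDerivAt (fun y : V => y - p) (ContinuousLinearMap.id ℝ V) y :=
    (hasFDerivAt_id y).sub_const p
  have h1 : HasFDerivAt (fun y : V => innerSL ℝ z (y - p)) (innerSL ℝ z) y :=
    (innerSL ℝ z).hasFDerivAt.comp y h0
  have h2 : HasFDerivAt (fun y : V => innerSL ℝ (y - p)) (innerSL ℝ (E := V)) y :=
    (innerSL ℝ (E := V)).hasFDerivAt.comp y h0
  have h := ((h2.const_smul (4 : ℝ)).const_sub ((-2 : ℝ) • innerSL ℝ z)).add
    ((h1.const_mul (2 * α)).smul_const (innerSL ℝ z))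
  have h' := congrArg (fun L => L w w') h.fderiv
  rw [fderiv_barrier]
  refine Eq.trans h' ?_
  simp
  rfl

/-- With `s = ⟨p - c, y - p⟩`, `|y - c|² - |p - c|² = 2s + |y - p|²`. The barrier subtracts `2|y -
p|²`, twice what the ball needs, and near `p` the term `α s²` is at most `|s|`; so the barrier is
nonnegative only at `p` and inside the ball. -/
theorem eventually_barrier_lt (c p : V) (α : ℝ) :
    ∀ᶠ y in 𝓝 p, 0 ≤ barrier p (p - c) α y → y = p ∨ dist y c < dist p c := by
  have hcont : Tendsto (fun y : V => |α * ⟪p - c, y - p⟫|) (𝓝 p) (𝓝 0) := by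
    have : Continuous (fun y : V => |α * ⟪p - c, y - p⟫|) := by fun_prop
    simpa using this.tendsto p
  filter_upwards [hcont.eventually (gt_mem_nhds (zero_lt_one' ℝ))] with y hy hb
  by_cases hyp : y = p
  · exact Or.inl hyp
  right
  rw [dist_eq_norm, dist_eq_norm, ← sq_lt_sq₀ (norm_nonneg _) (norm_nonneg _),
    show y - c = (p - c) + (y - p) by abel, norm_add_sq_real, ← real_inner_self_eq_norm_sq (y - p)]
  have hq : 0 < ⟪y - p, y - p⟫ := real_inner_self_pos.2 (sub_ne_zero.2 hyp)
  rw [barrier] at hb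
  obtain ⟨h1, h2⟩ := abs_lt.1 hy
  set s := ⟪p - c, y - p⟫
  have hs : s < 0 := by
    by_contra! hs
    nlinarith
  nlinarith

end Barrier

/-- At `p` the parameter `α` enters only through the second derivative, by `2αq` with `q = ∑ Aᵢⱼ zᵢ
zⱼ > 0`; a large `α` dominates all other terms. -/
theorem exists_secondOrderOp_barrier_pos {p z : Eucl n} (hA : (A p).PosDef) (hz : z ≠ 0) :
    ∃ α, 0 < secondOrderOp A b (barrier p z α) p := by
  have hq : 0 < ∑ i, ∑ j, A p i j * z i * z j := by
    have hz' : (fun i => z i) ≠ 0 := fun h => hz (by ext i; simpa using congrFun h i)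
    have := hA.dotProduct_mulVec_pos hz'
    simp only [dotProduct, Matrix.mulVec, star_trivial, Finset.mul_sum] at this
    refine this.trans_eq (Finset.sum_congr rfl fun i _ => Finset.sum_congr rfl fun j _ => by
      simp; ring)
  set q := ∑ i, ∑ j, A p i j * z i * z j with hqd
  have key : ∀ α, secondOrderOp A b (barrier p z α) p
      = 2 * α * q + secondOrderOp A b (barrier p z 0) p := by
    intro α
    have h1 : ∀ α, fderiv ℝ (barrier p z α) p (b p) = -2 * ⟪z, b p⟫ := fun α => by
      rw [fderiv_barrier]; simp
    simp only [secondOrderOp, h1, snd_fderiv_barrier]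
    rw [← add_assoc, hqd, Finset.mul_sum, ← Finset.sum_add_distrib]
    congr 1
    refine Finset.sum_congr rfl fun i _ => ?_
    rw [Finset.mul_sum, ← Finset.sum_add_distrib]
    refine Finset.sum_congr rfl fun j _ => ?_
    have h2 : ∀ i, ⟪z, (EuclideanSpace.single i 1 : Eucl n)⟫ = z i := fun i => by
      simp [EuclideanSpace.inner_single_right]
    rw [h2, h2]
    ring
  -- This `α` makes the operator equal to `1` at `p`.
  refine ⟨(1 - secondOrderOp A b (barrier p z 0) p) / (2 * q), ?_⟩
  rw [key]
  field_simp
  norm_num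

/-- Where `h ≥ 0`, the strict inequality `v < m` survives a small perturbation; where `h < 0`, every
positive `ε` pushes the sum below `m`. Compactness makes `ε` uniform. -/
theorem exists_pos_forall_lt {X : Type*} [TopologicalSpace X] {K : Set X} (hK : IsCompact K)
    {v h : X → ℝ} {m : ℝ} (hv : ∀ y ∈ K, ContinuousAt v y) (hh : ∀ y ∈ K, ContinuousAt h y)
    (hle : ∀ y ∈ K, ∀ᶠ x in 𝓝 y, v x ≤ m) (hlt : ∀ y ∈ K, 0 ≤ h y → v y < m) :
    ∃ ε > 0, ∀ y ∈ K, v y + ε * h y < m := by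
  have : ∀ᶠ ε in 𝓝 (0 : ℝ), ∀ y ∈ K, 0 < ε → v y + ε * h y < m := by
    refine hK.eventually_forall_of_forall_eventually (P := fun ε y => 0 < ε → v y + ε * h y < m)
      fun y hy => ?_
    rw [nhds_prod_eq]
    rcases le_or_gt 0 (h y) with h0 | h0
    · have hc : Tendsto (fun q : ℝ × X => v q.2 + q.1 * h q.2) (𝓝 0 ×ˢ 𝓝 y) (𝓝 (v y + 0 * h y)) :=
        ((hv y hy).tendsto.comp tendsto_snd).add
          (tendsto_fst.mul ((hh y hy).tendsto.comp tendsto_snd))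
      rw [zero_mul, add_zero] at hc
      exact (hc.eventually (gt_mem_nhds (hlt y hy h0))).mono fun q hq _ => hq
    · filter_upwards [tendsto_snd.eventually ((hh y hy).eventually (gt_mem_nhds h0)),
        tendsto_snd.eventually (hle y hy)] with q h1 h2 h3
      nlinarith
  obtain ⟨ε, h1, h2⟩ := (this.filter_mono nhdsWithin_le_nhds |>.and
    (self_mem_nhdsWithin : Set.Ioi (0 : ℝ) ∈ 𝓝[>] 0)).exists
  exact ⟨ε, h2, fun y hy => h1 y hy h2⟩

theorem continuousAt_secondOrderOp {U : Set (Eucl n)} (hU : IsOpen U) (hA : ContinuousOn A U)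
    (hb : ContinuousOn b U) {h : Eucl n → ℝ} (hh : ContDiff ℝ 2 h) {p : Eucl n} (hp : p ∈ U) :
    ContinuousAt (secondOrderOp A b h) p := by
  have hAp := hA.continuousAt (hU.mem_nhds hp)
  have hbp := hb.continuousAt (hU.mem_nhds hp)
  have h1 : ContDiff ℝ 1 (fderiv ℝ h) := hh.fderiv_right (by norm_num)
  have h2 : Continuous (fderiv ℝ (fderiv ℝ h)) := h1.continuous_fderiv (by simp)
  have hAij : ∀ i j, ContinuousAt (fun y => A y i j) p := fun i j =>
    ((continuous_apply_apply i j).continuousAt).comp hAp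
  unfold secondOrderOp
  have h3 : ∀ w w', ContinuousAt (fun y => fderiv ℝ (fderiv ℝ h) y w w') p := fun w w' =>
    ((h2.clm_apply continuous_const).clm_apply continuous_const).continuousAt
  have h4 : ContinuousAt (fun y => fderiv ℝ h y (b y)) p :=
    h1.continuous.continuousAt.clm_apply hbp
  refine ContinuousAt.add ?_ h4
  exact tendsto_finsetSum _ fun i _ => tendsto_finsetSum _ fun j _ => (hAij i j).mul (h3 _ _)

/-- **Strong maximum principle**: a subsolution of an elliptic equation is locally constant near
an interior maximum. -/
theorem eventually_eq_of_max {U : Set (Eucl n)} (hU : IsOpen U) {v : Eucl n → ℝ}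
    (hv : ContDiffOn ℝ 2 v U) (hA : ContinuousOn A U) (hb : ContinuousOn b U)
    (hpos : ∀ y ∈ U, (A y).PosDef) (hL : ∀ y ∈ U, 0 ≤ secondOrderOp A b v y) {m : ℝ}
    (hm : ∀ y ∈ U, v y ≤ m) {y₀ : Eucl n} (hy₀ : y₀ ∈ U) (hvy₀ : v y₀ = m) :
    ∀ᶠ y in 𝓝 y₀, v y = m := by
  have hvat : ∀ y ∈ U, ContDiffAt ℝ 2 v y := fun y hy => hv.contDiffAt (hU.mem_nhds hy)
  by_contra hcon
  obtain ⟨δ, hδ, hball⟩ := Metric.nhds_basis_closedBall.mem_iff.1 (hU.mem_nhds hy₀)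
  obtain ⟨c, hvc, hc⟩ := ((not_eventually.1 hcon).and_eventually
    (Metric.ball_mem_nhds y₀ (half_pos hδ))).exists
  have hK : IsCompact (Metric.closedBall y₀ δ ∩ v ⁻¹' {m}) :=
    (isCompact_closedBall y₀ δ).of_isClosed_subset
      ((hv.continuousOn.mono hball).preimage_isClosed_of_isClosed Metric.isClosed_closedBall
        isClosed_singleton) Set.inter_subset_left
  -- A point of the set `v = m` nearest to `c`: the open ball about `c` through `p` contains no
  -- maximum point of `closedBall y₀ δ`. Taking `c` within `δ/2` of `y₀` keeps `p` off the boundary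
  -- of that ball.
  obtain ⟨p, ⟨hp, hvp⟩, hmin⟩ := hK.exists_isMinOn
    ⟨y₀, Metric.mem_closedBall_self hδ.le, hvy₀⟩ (f := fun y => dist y c) (by fun_prop)
  have hdp : dist p c < δ / 2 :=
    (hmin ⟨Metric.mem_closedBall_self hδ.le, hvy₀⟩).trans_lt
    ((dist_comm y₀ c).trans_lt hc)
  have hpb : p ∈ Metric.ball y₀ δ := by
    have := dist_triangle p c y₀
    have : dist c y₀ < δ / 2 := hc
    rw [Metric.mem_ball]
    linarith
  have hpU : p ∈ U := hball hp
  have hz : p - c ≠ 0 := fun h => hvc (by rwa [sub_eq_zero.1 h] at hvp)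
  obtain ⟨α, hα⟩ := exists_secondOrderOp_barrier_pos (b := b) (hpos p hpU) hz
  set h := barrier p (p - c) α with hh
  have hcd : ContDiff ℝ 2 h := contDiff_barrier _ _ _
  have hev : ∀ᶠ y in 𝓝 p, y ∈ U ∧ (0 ≤ h y → y = p ∨ v y < m) ∧ 0 < secondOrderOp A b h y := by
    filter_upwards [hU.mem_nhds hpU, Metric.isOpen_ball.mem_nhds hpb, eventually_barrier_lt c p α,
      (continuousAt_secondOrderOp hU hA hb hcd hpU).eventually (lt_mem_nhds hα)] with y h1 h2 h3 h4
    refine ⟨h1, fun h0 => (h3 h0).imp_right fun hlt => (hm y h1).lt_of_ne fun he => ?_, h4⟩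
    exact hlt.not_ge (hmin ⟨Metric.ball_subset_closedBall h2, he⟩)
  obtain ⟨η, hη, hηb⟩ := Metric.nhds_basis_closedBall.mem_iff.1 hev
  have hsub := Metric.sphere_subset_closedBall (x := p) (ε := η)
  obtain ⟨ε, hε, hlt⟩ := exists_pos_forall_lt (isCompact_sphere p η) (v := v) (h := h) (m := m)
    (fun y hy => (hvat y (hηb (hsub hy)).1).continuousAt) (fun y _ => hcd.continuous.continuousAt)
    (fun y hy => eventually_of_mem (hU.mem_nhds (hηb (hsub hy)).1) hm)
    (fun y hy h0 => ((hηb (hsub hy)).2.1 h0).resolve_left fun h1 => by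
      rw [h1] at hy; simp at hy; exact hη.ne hy)
  have hcont : ContinuousOn (fun y => v y + ε * h y) (Metric.closedBall p η) := fun y hy =>
    ((hvat y (hηb hy).1).continuousAt.add
      (hcd.continuous.continuousAt.const_mul ε)).continuousWithinAt
  -- The perturbed function equals `m` at `p` and is below `m` on the small sphere, so its maximum
  -- is interior. There the operator is nonpositive, although it is nonnegative on `v` and positive
  -- on `h`.
  obtain ⟨q, hq, hqmax⟩ := (isCompact_closedBall p η).exists_isMaxOn
    ⟨p, Metric.mem_closedBall_self hη.le⟩ hcont
  have hqm : m ≤ v q + ε * h q := by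
    have := hqmax (Metric.mem_closedBall_self hη.le)
    simpa [hh, barrier, show v p = m from hvp] using this
  have hqb : q ∈ Metric.ball p η :=
    lt_of_le_of_ne hq fun he => (hlt q he).not_ge hqm
  have hloc : IsLocalMax (fun y => v y + ε * h y) q :=
    hqmax.isLocalMax (mem_of_superset (Metric.isOpen_ball.mem_nhds hqb) Metric.ball_subset_closedBall)
  obtain ⟨hqU, -, hLh⟩ := hηb hq
  have h1 := secondOrderOp_nonpos_of_isLocalMax (b := b) (hpos q hqU).posSemidef
    ((hvat q hqU).add (contDiffAt_const.mul hcd.contDiffAt)) hloc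
  rw [secondOrderOp_add_const_mul (hvat q hqU) hcd.contDiffAt] at h1
  have h2 := hL q hqU
  have h3 := mul_pos hε hLh
  linarith

end MaximumPrinciple

/-! ### Parametrized hypersurfaces and the Laplacian of `|F|²/2`. -/

section LocalGeometry

variable {n : ℕ}

/-- The vectors of the standard basis. -/
abbrev basisVec (i : Fin n) : Eucl n := EuclideanSpace.single i 1

theorem linearIndependent_basisVec : LinearIndependent ℝ (basisVec (n := n)) := by
  have : basisVec (n := n) = (EuclideanSpace.basisFun (Fin n) ℝ).toBasis := by
    ext1 i
    simp
  rw [this]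
  exact (EuclideanSpace.basisFun (Fin n) ℝ).toBasis.linearIndependent

/-- A vector is the sum of its normal and tangential components. -/
theorem eq_normal_add_tangential {t : Fin n → Eucl (n + 1)} (ht : LinearIndependent ℝ t)
    {ν : Eucl (n + 1)} (hν : ‖ν‖ = 1) (hνt : ∀ i, ⟪ν, t i⟫ = 0) (x : Eucl (n + 1)) :
    x = ⟪x, ν⟫ • ν + ∑ k, (∑ l, (Matrix.gram ℝ t)⁻¹ k l * ⟪x, t l⟫) • t k := by
  have hG : IsUnit (Matrix.gram ℝ t).det := (posDef_gram_of_linearIndependent ht).det_pos.ne'.isUnit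
  have hνν : ⟪ν, ν⟫ = 1 := by rw [real_inner_self_eq_norm_sq, hν]; norm_num
  set S := Submodule.span ℝ (Set.range t)
  have hmem : ∀ z : Eucl (n + 1), z ∈ Sᗮ ↔ ∀ i, ⟪z, t i⟫ = 0 := by
    intro z
    rw [Submodule.mem_orthogonal']
    refine ⟨fun h i => h _ (Submodule.subset_span ⟨i, rfl⟩), fun h u hu => ?_⟩
    induction hu using Submodule.span_induction with
    | mem u hu => obtain ⟨i, rfl⟩ := hu; exact h i
    | zero => simp
    | add a b _ _ ha hb => rw [inner_add_right, ha, hb, add_zero]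
    | smul c a _ ha => rw [inner_smul_right, ha, mul_zero]
  -- The normal space is a line spanned by `ν`, so a vector that is orthogonal to the frame and to
  -- `ν` is zero.
  have hrank : Module.finrank ℝ Sᗮ = 1 := by
    have h1 := S.finrank_add_finrank_orthogonal
    rw [finrank_span_eq_card ht] at h1
    simp at h1
    omega
  set y := x - (⟪x, ν⟫ • ν + ∑ k, (∑ l, (Matrix.gram ℝ t)⁻¹ k l * ⟪x, t l⟫) • t k) with hy
  have hyS : y ∈ Sᗮ := by
    rw [hmem]
    intro i
    have key : ∑ k, (∑ l, (Matrix.gram ℝ t)⁻¹ k l * ⟪x, t l⟫) * ⟪t k, t i⟫ = ⟪x, t i⟫ := by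
      have h1 : (Matrix.gram ℝ t) *ᵥ ((Matrix.gram ℝ t)⁻¹ *ᵥ fun l => ⟪x, t l⟫) = fun l => ⟪x, t l⟫ := by
        rw [mulVec_mulVec, Matrix.mul_nonsing_inv _ hG, one_mulVec]
      refine Eq.trans ?_ (congrFun h1 i)
      simp only [mulVec, dotProduct, gram_apply]
      refine Finset.sum_congr rfl fun k _ => ?_
      rw [mul_comm, real_inner_comm]
    rw [hy, inner_sub_left, inner_add_left, inner_smul_left, hνt, sum_inner]
    simp only [inner_smul_left, RCLike.conj_to_real]
    rw [key]
    ring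
  have hyν : ⟪y, ν⟫ = 0 := by
    rw [hy, inner_sub_left, inner_add_left, inner_smul_left, hνν, sum_inner]
    have hνt' : ∀ i, ⟪t i, ν⟫ = 0 := fun i => by rw [real_inner_comm, hνt]
    simp only [inner_smul_left, RCLike.conj_to_real, hνt']
    simp
  have hν0 : (⟨ν, (hmem ν).2 hνt⟩ : Sᗮ) ≠ 0 := fun h => by
    have : ν = 0 := congrArg Subtype.val h
    rw [this] at hν; simp at hν
  obtain ⟨c, hc⟩ := (finrank_eq_one_iff_of_nonzero' _ hν0).1 hrank ⟨y, hyS⟩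
  have hc' : c • ν = y := congrArg Subtype.val hc
  have hc0 : c = 0 := by
    rw [← hc', inner_smul_left, hνν] at hyν
    simpa using hyν
  rw [← sub_eq_zero, ← hy, ← hc', hc0, zero_smul]

/-- A hypersurface parametrized by an open set of the Euclidean space, with its unit normal. -/
structure IsParametrizedHypersurface (F N : Eucl n → Eucl (n + 1)) (U : Set (Eucl n)) : Prop where
  isOpen : IsOpen U
  smooth : ContDiffOn ℝ ∞ F U
  immersion : ∀ y ∈ U, Function.Injective (fderiv ℝ F y)
  smooth_normal : ContDiffOn ℝ ∞ N U
  norm_normal : ∀ y ∈ U, ‖N y‖ = 1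
  normal : ∀ y ∈ U, ∀ w, ⟪N y, fderiv ℝ F y w⟫ = 0

/-- The coordinate frame of a parametrized hypersurface. -/
def frame (F : Eucl n → Eucl (n + 1)) (y : Eucl n) (i : Fin n) : Eucl (n + 1) :=
  fderiv ℝ F y (basisVec i)

/-- The second fundamental form of a parametrized hypersurface, in coordinates. -/
def frameSecondFF (F N : Eucl n → Eucl (n + 1)) (y : Eucl n) : Matrix (Fin n) (Fin n) ℝ :=
  Matrix.of fun i j => -⟪frame N y i, frame F y j⟫

/-- The drift of the Laplacian of the induced metric in coordinates. -/
def laplacianDrift (F : Eucl n → Eucl (n + 1)) (y : Eucl n) : Eucl n :=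
  -∑ l, (∑ i, ∑ j, (Matrix.gram ℝ (frame F y))⁻¹ i j * ∑ k, (Matrix.gram ℝ (frame F y))⁻¹ k l *
    ⟪frame F y k, fderiv ℝ (fderiv ℝ F) y (basisVec i) (basisVec j)⟫) • basisVec l

namespace IsParametrizedHypersurface

variable {F N : Eucl n → Eucl (n + 1)} {U : Set (Eucl n)}

theorem contDiffAt (h : IsParametrizedHypersurface F N U) {y : Eucl n} (hy : y ∈ U) :
    ContDiffAt ℝ ∞ F y :=
  h.smooth.contDiffAt (h.isOpen.mem_nhds hy)

theorem contDiffAt_normal (h : IsParametrizedHypersurface F N U) {y : Eucl n} (hy : y ∈ U) :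
    ContDiffAt ℝ ∞ N y :=
  h.smooth_normal.contDiffAt (h.isOpen.mem_nhds hy)

theorem differentiableAt (h : IsParametrizedHypersurface F N U) {y : Eucl n} (hy : y ∈ U) :
    DifferentiableAt ℝ F y :=
  (h.contDiffAt hy).differentiableAt (by simp)

theorem contDiffAt_fderiv (h : IsParametrizedHypersurface F N U) {y : Eucl n} (hy : y ∈ U) :
    ContDiffAt ℝ 1 (fderiv ℝ F) y :=
  (h.contDiffAt hy).fderiv_right (by norm_cast)

theorem linearIndependent_frame (h : IsParametrizedHypersurface F N U) {y : Eucl n} (hy : y ∈ U) :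
    LinearIndependent ℝ (frame F y) := by
  exact linearIndependent_basisVec.map' (fderiv ℝ F y).toLinearMap (LinearMap.ker_eq_bot.2 (h.immersion y hy))

theorem posDef_gram_frame (h : IsParametrizedHypersurface F N U) {y : Eucl n} (hy : y ∈ U) :
    (Matrix.gram ℝ (frame F y)).PosDef :=
  posDef_gram_of_linearIndependent (h.linearIndependent_frame hy)

/-- The normal component of the second derivative is the second fundamental form. -/
theorem inner_normal_snd_fderiv (h : IsParametrizedHypersurface F N U) {y : Eucl n} (hy : y ∈ U)
    (w w' : Eucl n) :
    ⟪N y, fderiv ℝ (fderiv ℝ F) y w w'⟫ = -⟪fderiv ℝ N y w, fderiv ℝ F y w'⟫ := by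
  have h1 : HasFDerivAt N (fderiv ℝ N y) y :=
    ((h.contDiffAt_normal hy).differentiableAt (by simp)).hasFDerivAt
  have h2 : HasFDerivAt (fderiv ℝ F) (fderiv ℝ (fderiv ℝ F) y) y :=
    ((h.contDiffAt_fderiv hy).differentiableAt (by simp)).hasFDerivAt
  have h3 := h1.inner ℝ (h2.clm_apply (hasFDerivAt_const w' y))
  -- This function vanishes identically near `y`; its derivative gives the identity.
  have h4 : (fun y => ⟪N y, fderiv ℝ F y w'⟫) =ᶠ[𝓝 y] fun _ => 0 :=
    eventually_of_mem (h.isOpen.mem_nhds hy) fun z hz => h.normal z hz w'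
  have h5 := congrArg (fun L => L w) (h3.fderiv.symm.trans h4.fderiv_eq)
  simp at h5
  linarith

theorem fderiv_half_norm_sq (h : IsParametrizedHypersurface F N U) {y : Eucl n} (hy : y ∈ U) :
    HasFDerivAt (fun y => ‖F y‖ ^ 2 / 2) ((innerSL ℝ (F y)).comp (fderiv ℝ F y)) y := by
  have h1 := (h.differentiableAt hy).hasFDerivAt.norm_sq.mul_const (2⁻¹ : ℝ)
  simp only [← div_eq_mul_inv] at h1
  refine h1.congr_fderiv ?_
  ext w
  simp

theorem snd_fderiv_half_norm_sq (h : IsParametrizedHypersurface F N U) {y : Eucl n} (hy : y ∈ U)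
    (w w' : Eucl n) :
    fderiv ℝ (fderiv ℝ fun y => ‖F y‖ ^ 2 / 2) y w w'
      = ⟪fderiv ℝ F y w, fderiv ℝ F y w'⟫ + ⟪F y, fderiv ℝ (fderiv ℝ F) y w w'⟫ := by
  set u : Eucl n → ℝ := fun y => ‖F y‖ ^ 2 / 2
  have hu : ContDiffAt ℝ 2 u y := (((h.contDiffAt hy).of_le (by norm_cast)).norm_sq ℝ).div_const 2
  have h1 : HasFDerivAt (fderiv ℝ u) (fderiv ℝ (fderiv ℝ u) y) y :=
    ((hu.fderiv_right (m := 1) (by norm_num)).differentiableAt (by simp)).hasFDerivAt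
  have h2 : HasFDerivAt (fderiv ℝ F) (fderiv ℝ (fderiv ℝ F) y) y :=
    ((h.contDiffAt_fderiv hy).differentiableAt (by simp)).hasFDerivAt
  have h3 := (h.differentiableAt hy).hasFDerivAt.inner ℝ (h2.clm_apply (hasFDerivAt_const w' y))
  have h4 : (fun y => fderiv ℝ u y w') =ᶠ[𝓝 y] fun y => ⟪F y, fderiv ℝ F y w'⟫ :=
    eventually_of_mem (h.isOpen.mem_nhds hy) fun z hz => by
      simp only [u, (h.fderiv_half_norm_sq hz).fderiv]
      rfl
  have h5 := congrArg (fun L => L w)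
    ((h1.clm_apply (hasFDerivAt_const w' y)).fderiv.symm.trans (h4.fderiv_eq.trans h3.fderiv))
  simp at h5
  rw [h5, add_comm]

/-- Matches the tangential part of `⟨F, ∂ᵢ∂ⱼF⟩`, traced with the inverse metric, with the drift
term, so that the two cancel. -/
theorem sum_mul_sum_mul_comm {ι : Type*} [Fintype ι] (a : ι → ι → ℝ)
    (X : ι → ι → ι → ℝ) (φ : ι → ℝ) :
    ∑ i, ∑ j, a i j * ∑ k, (∑ l, a k l * φ l) * X k i j
      = ∑ l, (∑ i, ∑ j, a i j * ∑ k, a k l * X k i j) * φ l := by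
  simp only [Finset.mul_sum, Finset.sum_mul]
  symm
  rw [Finset.sum_comm]
  refine Finset.sum_congr rfl fun i _ => ?_
  rw [Finset.sum_comm]
  refine Finset.sum_congr rfl fun j _ => ?_
  rw [Finset.sum_comm]
  exact Finset.sum_congr rfl fun k _ => Finset.sum_congr rfl fun l _ => by ring

/-- The Laplacian of `|F|² / 2` is `n - H ⟪F, N⟫`, where `H` is minus the trace of the second
fundamental form. -/
theorem secondOrderOp_half_norm_sq (h : IsParametrizedHypersurface F N U) {y : Eucl n}
    (hy : y ∈ U) :
    secondOrderOp (fun y => (Matrix.gram ℝ (frame F y))⁻¹) (laplacianDrift F) (fun y => ‖F y‖ ^ 2 / 2) y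
      = n + ((Matrix.gram ℝ (frame F y))⁻¹ * frameSecondFF F N y).trace * ⟪F y, N y⟫ := by
  have hG := h.posDef_gram_frame hy
  have hGu : IsUnit (Matrix.gram ℝ (frame F y)).det := hG.det_pos.ne'.isUnit
  have hsymm : ∀ i j, (Matrix.gram ℝ (frame F y))⁻¹ i j = (Matrix.gram ℝ (frame F y))⁻¹ j i := fun i j => by
    simpa using hG.inv.isHermitian.apply j i
  -- Splitting `F` into normal and tangential parts: the normal part carries the second fundamental
  -- form, the tangential part the Christoffel symbols.
  have hsnd : ∀ i j, ⟪F y, fderiv ℝ (fderiv ℝ F) y (basisVec i) (basisVec j)⟫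
      = ⟪F y, N y⟫ * frameSecondFF F N y i j + ∑ k, (∑ l, (Matrix.gram ℝ (frame F y))⁻¹ k l *
        ⟪F y, frame F y l⟫) * ⟪frame F y k, fderiv ℝ (fderiv ℝ F) y (basisVec i) (basisVec j)⟫ := by
    intro i j
    conv_lhs => rw [eq_normal_add_tangential (h.linearIndependent_frame hy) (h.norm_normal y hy)
      (fun i => h.normal y hy _) (F y)]
    rw [inner_add_left, inner_smul_left, sum_inner, h.inner_normal_snd_fderiv hy]
    simp only [inner_smul_left, RCLike.conj_to_real]
    rfl
  have htr : ∑ i, ∑ j, (Matrix.gram ℝ (frame F y))⁻¹ i j * Matrix.gram ℝ (frame F y) i j = n := by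
    have h1 : ((Matrix.gram ℝ (frame F y))⁻¹ * Matrix.gram ℝ (frame F y)).trace = n := by
      rw [Matrix.nonsing_inv_mul _ hGu]; simp
    rw [← h1]
    simp only [Matrix.trace, Matrix.diag_apply, Matrix.mul_apply]
    refine Finset.sum_congr rfl fun i _ => Finset.sum_congr rfl fun j _ => ?_
    rw [gram_apply, gram_apply, real_inner_comm]
  have htr2 : ∑ i, ∑ j, (Matrix.gram ℝ (frame F y))⁻¹ i j * frameSecondFF F N y i j
      = ((Matrix.gram ℝ (frame F y))⁻¹ * frameSecondFF F N y).trace := by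
    simp only [Matrix.trace, Matrix.diag_apply, Matrix.mul_apply]
    rw [Finset.sum_comm]
    exact Finset.sum_congr rfl fun i _ => Finset.sum_congr rfl fun j _ => by rw [hsymm]
  have hdrift : fderiv ℝ (fun y => ‖F y‖ ^ 2 / 2) y (laplacianDrift F y)
      = -∑ l, (∑ i, ∑ j, (Matrix.gram ℝ (frame F y))⁻¹ i j * ∑ k, (Matrix.gram ℝ (frame F y))⁻¹ k l *
        ⟪frame F y k, fderiv ℝ (fderiv ℝ F) y (basisVec i) (basisVec j)⟫) * ⟪F y, frame F y l⟫ := by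
    rw [(h.fderiv_half_norm_sq hy).fderiv, laplacianDrift, map_neg, map_sum]
    simp only [map_smul, smul_eq_mul]
    rfl
  have hs := sum_mul_sum_mul_comm (fun i j => (Matrix.gram ℝ (frame F y))⁻¹ i j)
    (fun k i j => ⟪frame F y k, fderiv ℝ (fderiv ℝ F) y (basisVec i) (basisVec j)⟫)
    (fun l => ⟪F y, frame F y l⟫)
  rw [secondOrderOp, hdrift, ← hs, ← htr, ← htr2, Finset.sum_mul,
    ← Finset.sum_neg_distrib, ← Finset.sum_add_distrib, ← Finset.sum_add_distrib]
  refine Finset.sum_congr rfl fun i _ => ?_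
  rw [Finset.sum_mul, ← Finset.sum_neg_distrib, ← Finset.sum_add_distrib, ← Finset.sum_add_distrib]
  refine Finset.sum_congr rfl fun j _ => ?_
  rw [h.snd_fderiv_half_norm_sq hy, hsnd, gram_apply]
  simp only [frame]
  ring

theorem continuousOn_inv_gram (h : IsParametrizedHypersurface F N U) :
    ContinuousOn (fun y => (Matrix.gram ℝ (frame F y))⁻¹) U := by
  have hc : ContinuousOn (fun y => Matrix.gram ℝ (frame F y)) U := by
    refine continuousOn_pi.2 fun i => continuousOn_pi.2 fun j => ?_
    have hf : ∀ i, ContinuousOn (fun y => frame F y i) U := fun i y hy =>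
      ((h.contDiffAt_fderiv hy).continuousAt.clm_apply continuousAt_const).continuousWithinAt
    exact ContinuousOn.inner (𝕜 := ℝ) (hf i) (hf j)
  simp only [Matrix.inv_def, Ring.inverse_eq_inv']
  have hdet : ContinuousOn (fun y => (Matrix.gram ℝ (frame F y)).det) U :=
    (Continuous.matrix_det continuous_id).comp_continuousOn hc
  have hadj : ContinuousOn (fun y => (Matrix.gram ℝ (frame F y)).adjugate) U :=
    (Continuous.matrix_adjugate continuous_id).comp_continuousOn hc
  exact (hdet.inv₀ fun y hy => (h.posDef_gram_frame hy).det_pos.ne').smul hadj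

theorem continuousOn_laplacianDrift (h : IsParametrizedHypersurface F N U) :
    ContinuousOn (laplacianDrift F) U := by
  have hg : ∀ i j, ContinuousOn (fun y => (Matrix.gram ℝ (frame F y))⁻¹ i j) U := fun i j =>
    (continuous_apply_apply i j).comp_continuousOn h.continuousOn_inv_gram
  have hf : ∀ i, ContinuousOn (fun y => frame F y i) U := fun i y hy =>
    ((h.contDiffAt_fderiv hy).continuousAt.clm_apply continuousAt_const).continuousWithinAt
  have h2 : ∀ w w', ContinuousOn (fun y => fderiv ℝ (fderiv ℝ F) y w w') U := fun w w' y hy => by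
    have h1 : ContDiffAt ℝ 0 (fderiv ℝ (fderiv ℝ F)) y :=
      (h.contDiffAt_fderiv hy).fderiv_right (by norm_num)
    exact ((h1.continuousAt.clm_apply continuousAt_const).clm_apply
      continuousAt_const).continuousWithinAt
  unfold laplacianDrift
  refine ContinuousOn.neg (continuousOn_finsetSum _ fun l _ => ContinuousOn.smul
    (continuousOn_finsetSum _ fun i _ => continuousOn_finsetSum _ fun j _ => (hg i j).mul
      (continuousOn_finsetSum _ fun k _ => (hg k l).mul (ContinuousOn.inner (𝕜 := ℝ) (hf k) (h2 _ _))))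
    continuousOn_const)

/-- The strong maximum principle is applied to `|F|²/2`, which is smooth even where `F = 0`. -/
theorem eventually_norm_eq (h : IsParametrizedHypersurface F N U)
    (hsub : ∀ y ∈ U,
      0 ≤ n + ((Matrix.gram ℝ (frame F y))⁻¹ * frameSecondFF F N y).trace * ⟪F y, N y⟫)
    {r : ℝ} (hr : ∀ y ∈ U, ‖F y‖ ≤ r) {y₀ : Eucl n} (hy₀ : y₀ ∈ U) (h₀ : ‖F y₀‖ = r) :
    ∀ᶠ y in 𝓝 y₀, ‖F y‖ = r := by
  have hr0 : 0 ≤ r := h₀ ▸ norm_nonneg _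
  have h1 : ContDiffOn ℝ 2 (fun y => ‖F y‖ ^ 2 / 2) U :=
    ((h.smooth.of_le (by norm_cast)).norm_sq ℝ).div_const 2
  have := eventually_eq_of_max h.isOpen h1 h.continuousOn_inv_gram h.continuousOn_laplacianDrift
    (fun y hy => (h.posDef_gram_frame hy).inv)
    (fun y hy => by rw [h.secondOrderOp_half_norm_sq hy]; exact hsub y hy) (m := r ^ 2 / 2)
    (fun y hy => by have := hr y hy; gcongr) hy₀ (by rw [h₀])
  filter_upwards [this] with y hy
  rw [← sq_eq_sq₀ (norm_nonneg _) hr0]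
  linarith

theorem trace_mul_inner_le_of_isLocalMax (h : IsParametrizedHypersurface F N U) {y : Eucl n}
    (hy : y ∈ U) (hmax : IsLocalMax (fun y => ‖F y‖) y) :
    n + ((Matrix.gram ℝ (frame F y))⁻¹ * frameSecondFF F N y).trace * ⟪F y, N y⟫ ≤ 0 := by
  rw [← h.secondOrderOp_half_norm_sq hy]
  refine secondOrderOp_nonpos_of_isLocalMax (h.posDef_gram_frame hy).inv.posSemidef
    ((((h.contDiffAt hy).of_le (by norm_cast)).norm_sq ℝ).div_const 2) ?_
  filter_upwards [hmax] with z hz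
  gcongr

/-- At a local maximum of the norm the position vector is normal. -/
theorem sq_inner_eq_of_isLocalMax (h : IsParametrizedHypersurface F N U) {y : Eucl n}
    (hy : y ∈ U) (hmax : IsLocalMax (fun y => ‖F y‖) y) : ⟪F y, N y⟫ ^ 2 = ‖F y‖ ^ 2 := by
  have h0 : ∀ i, ⟪F y, frame F y i⟫ = 0 := fun i => by
    have hm : IsLocalMax (fun y => ‖F y‖ ^ 2 / 2) y := by
      filter_upwards [hmax] with z hz
      gcongr
    have := hm.fderiv_eq_zero
    rw [(h.fderiv_half_norm_sq hy).fderiv] at this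
    exact congrArg (fun L => L (basisVec i)) this
  have h1 := eq_normal_add_tangential (h.linearIndependent_frame hy) (h.norm_normal y hy)
      (fun i => h.normal y hy _) (F y)
  simp only [h0, mul_zero, Finset.sum_const_zero, zero_smul, add_zero] at h1
  conv_rhs => rw [h1, norm_smul, h.norm_normal y hy, mul_one, Real.norm_eq_abs, sq_abs]

end IsParametrizedHypersurface

end LocalGeometry

/-! ### Passage from charts to the manifold. -/

section Charts

variable {n : ℕ}

/-- The mean curvature does not depend on the basis of the tangent space. -/
theorem trace_inv_mul_congruence {G S J : Matrix (Fin n) (Fin n) ℝ}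
    (h : IsUnit (Jᵀ * G * J).det) : ((Jᵀ * G * J)⁻¹ * (Jᵀ * S * J)).trace = (G⁻¹ * S).trace := by
  have hJ : IsUnit J.det := by
    rw [det_mul] at h
    exact isUnit_of_mul_isUnit_right h
  have hJt : IsUnit Jᵀ.det := by rwa [det_transpose]
  rw [Matrix.mul_inv_rev, Matrix.mul_inv_rev]
  have : J⁻¹ * (G⁻¹ * Jᵀ⁻¹) * (Jᵀ * S * J) = J⁻¹ * (G⁻¹ * S * J) := by
    simp only [Matrix.mul_assoc]
    rw [Matrix.nonsing_inv_mul_cancel_left _ _ hJt]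
  rw [this, Matrix.trace_mul_comm, Matrix.mul_assoc, Matrix.mul_nonsing_inv _ hJ, Matrix.mul_one]

/-- The matrix of an endomorphism of the Euclidean space in the standard basis. -/
def coordMatrix (T : Eucl n →L[ℝ] Eucl n) : Matrix (Fin n) (Fin n) ℝ :=
  Matrix.of fun k i => T (basisVec i) k

theorem inner_comp_eq_congruence {W : Type*} [NormedAddCommGroup W] [InnerProductSpace ℝ W]
    (D D' : Eucl n →L[ℝ] W) (T : Eucl n →L[ℝ] Eucl n) :
    (Matrix.of fun i j => ⟪D (T (basisVec i)), D' (T (basisVec j))⟫)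
      = (coordMatrix T)ᵀ * (Matrix.of fun i j => ⟪D (basisVec i), D' (basisVec j)⟫)
        * coordMatrix T := by
  have hT : ∀ i, T (basisVec i) = ∑ k, coordMatrix T k i • basisVec k := fun i => by
    ext l
    simp [coordMatrix, Finset.sum_apply, Pi.single_apply]
  ext i j
  simp only [Matrix.of_apply, Matrix.mul_apply, Matrix.transpose_apply]
  rw [hT i, hT j]
  simp only [map_sum, map_smul, sum_inner, inner_sum, inner_smul_left, inner_smul_right,
    RCLike.conj_to_real, Finset.sum_mul]
  refine Finset.sum_congr rfl fun k _ => ?_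
  rw [Finset.mul_sum]
  exact Finset.sum_congr rfl fun l _ => by ring

variable {M : Type*} [TopologicalSpace M] [ChartedSpace (Eucl n) M] {f N : M → Eucl (n + 1)}

theorem IsImmersedHypersurface.inner_mfderiv (h : IsImmersedHypersurface f N) (q : M) (w : Eucl n) :
    ⟪N q, (mfderiv (𝓡 n) 𝓘(ℝ, Eucl (n + 1)) f q : Eucl n →L[ℝ] Eucl (n + 1)) w⟫ = 0 := by
  have key : ∀ D : Eucl n →L[ℝ] Eucl (n + 1), (∀ k, ⟪N q, D (basisVec k)⟫ = 0) →
      ⟪N q, D w⟫ = 0 := by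
    intro D hD
    have hw : w = ∑ k, w k • basisVec k := by
      ext l
      simp [Finset.sum_apply, Pi.single_apply]
    rw [hw, map_sum, inner_sum]
    refine Finset.sum_eq_zero fun k _ => ?_
    rw [map_smul, inner_smul_right, hD, mul_zero]
  exact key _ (h.normal q)

theorem IsImmersedHypersurface.posDef_gram (h : IsImmersedHypersurface f N) (p : M) :
    (gram f p).PosDef := by
  exact posDef_gram_of_linearIndependent (linearIndependent_basisVec.map'
    (mfderiv (𝓡 n) 𝓘(ℝ, Eucl (n + 1)) f p : Eucl n →L[ℝ] Eucl (n + 1)).toLinearMap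
    (LinearMap.ker_eq_bot.2 (h.immersion p)))

theorem IsImmersedHypersurface.sq_meanCurvature_le (h : IsImmersedHypersurface f N) (p : M) :
    meanCurvature f N p ^ 2 ≤ n * normSqA f N p := by
  rw [meanCurvature, neg_sq]
  exact trace_sq_le_of_posSemidef (h.posDef_gram p).inv.posSemidef _

variable [IsManifold (𝓡 n) ∞ M]

/-- A map read in a chart. -/
def inChart {m : ℕ} (p : M) (g : M → Eucl m) : Eucl n → Eucl m := g ∘ (extChartAt (𝓡 n) p).symm

theorem contDiffOn_inChart {m : ℕ} (p : M) {g : M → Eucl m}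
    (hg : ContMDiff (𝓡 n) 𝓘(ℝ, Eucl m) ∞ g) :
    ContDiffOn ℝ ∞ (inChart p g) (extChartAt (𝓡 n) p).target :=
  contMDiffOn_iff_contDiffOn.1 (hg.comp_contMDiffOn (contMDiffOn_extChartAt_symm p))

/-- `T` is the derivative of the inverse chart. It is the same for all `g`, so the metric and the
second fundamental form transform by one matrix. -/
theorem exists_fderiv_inChart {p : M} {y : Eucl n} (hy : y ∈ (extChartAt (𝓡 n) p).target) :
    ∃ T : Eucl n ≃L[ℝ] Eucl n, ∀ (m : ℕ) (g : M → Eucl m), ContMDiff (𝓡 n) 𝓘(ℝ, Eucl m) ∞ g →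
      fderiv ℝ (inChart p g) y =
        (mfderiv (𝓡 n) 𝓘(ℝ, Eucl m) g ((extChartAt (𝓡 n) p).symm y) :
          Eucl n →L[ℝ] Eucl m).comp (T : Eucl n →L[ℝ] Eucl n) := by
  have : IsManifold (𝓡 n) 1 M := .of_le (n := ∞) (by norm_cast)
  obtain ⟨T, hT⟩ := isInvertible_mfderivWithin_extChartAt_symm hy
  refine ⟨T, fun m g hg => ?_⟩
  have h1 : MDifferentiableAt 𝓘(ℝ, Eucl n) (𝓡 n) (extChartAt (𝓡 n) p).symm y := by
    have := mdifferentiableWithinAt_extChartAt_symm hy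
    rwa [ModelWithCorners.range_eq_univ, mdifferentiableWithinAt_univ] at this
  have h2 := mfderiv_comp y (hg.mdifferentiableAt (by simp)) h1
  rw [← mfderiv_eq_fderiv]
  refine Eq.trans h2 ?_
  rw [ModelWithCorners.range_eq_univ, mfderivWithin_univ] at hT
  rw [← hT]
  rfl

theorem IsImmersedHypersurface.isParametrized (h : IsImmersedHypersurface f N) (p : M) :
    IsParametrizedHypersurface (inChart p f) (inChart p N) (extChartAt (𝓡 n) p).target where
  isOpen := isOpen_extChartAt_target p
  smooth := contDiffOn_inChart p h.smooth
  immersion y hy := by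
    obtain ⟨T, hT⟩ := exists_fderiv_inChart hy
    rw [hT _ f h.smooth]
    exact (h.immersion _).comp T.injective
  smooth_normal := contDiffOn_inChart p h.smooth_normal
  norm_normal y _ := h.norm_normal _
  normal y hy w := by
    obtain ⟨T, hT⟩ := exists_fderiv_inChart hy
    rw [hT _ f h.smooth]
    exact h.inner_mfderiv _ _

theorem IsImmersedHypersurface.trace_inChart (h : IsImmersedHypersurface f N) (p : M) {y : Eucl n}
    (hy : y ∈ (extChartAt (𝓡 n) p).target) :
    ((Matrix.gram ℝ (frame (inChart p f) y))⁻¹ *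
        frameSecondFF (inChart p f) (inChart p N) y).trace
      = -meanCurvature f N ((extChartAt (𝓡 n) p).symm y) := by
  obtain ⟨T, hT⟩ := exists_fderiv_inChart hy
  set q := (extChartAt (𝓡 n) p).symm y
  set D : Eucl n →L[ℝ] Eucl (n + 1) := mfderiv (𝓡 n) 𝓘(ℝ, Eucl (n + 1)) f q
  set D' : Eucl n →L[ℝ] Eucl (n + 1) := mfderiv (𝓡 n) 𝓘(ℝ, Eucl (n + 1)) N q
  have hG : Matrix.gram ℝ (frame (inChart p f) y)
      = (coordMatrix T)ᵀ * gram f q * coordMatrix T := by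
    have := inner_comp_eq_congruence D D T
    refine Eq.trans ?_ this
    ext i j
    simp only [gram_apply, frame, hT _ f h.smooth]
    rfl
  have hS : frameSecondFF (inChart p f) (inChart p N) y
      = (coordMatrix T)ᵀ * secondFF f N q * coordMatrix T := by
    have := inner_comp_eq_congruence (-D') D T
    simp only [_root_.neg_apply, inner_neg_left] at this
    refine Eq.trans ?_ this
    ext i j
    simp only [frameSecondFF, frame, hT _ f h.smooth, hT _ N h.smooth_normal]
    rfl
  have hu := ((h.isParametrized p).posDef_gram_frame hy).det_pos.ne'.isUnit
  rw [hG] at hu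
  rw [hG, hS, trace_inv_mul_congruence hu, meanCurvature, neg_neg]

/-- At the farthest point `f p = ±|f p| N p`, and `hpos` selects the plus sign; the rest is that the
Laplacian of `|f|²/2` is nonpositive there. -/
theorem IsImmersedHypersurface.le_meanCurvature_mul_of_max (h : IsImmersedHypersurface f N) {p : M}
    (hp : ∀ q, ‖f q‖ ≤ ‖f p‖) (hpos : 0 < ⟪f p, N p⟫) :
    0 < ‖f p‖ ∧ ⟪f p, N p⟫ = ‖f p‖ ∧ n ≤ meanCurvature f N p * ‖f p‖ := by
  have hy := mem_extChartAt_target (I := 𝓡 n) p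
  set y := extChartAt (𝓡 n) p p
  have hq : (extChartAt (𝓡 n) p).symm y = p := extChartAt_to_inv p
  have hF : inChart p f y = f p := congrArg f hq
  have hN : inChart p N y = N p := congrArg N hq
  have hmax : IsLocalMax (fun y => ‖inChart p f y‖) y :=
    Eventually.of_forall fun z => by
      simp only [hF]
      exact hp _
  have h1 := (h.isParametrized p).sq_inner_eq_of_isLocalMax hy hmax
  have h2 := (h.isParametrized p).trace_mul_inner_le_of_isLocalMax hy hmax
  rw [h.trace_inChart p hy, hq] at h2
  rw [hF, hN] at h1 h2
  have h3 : ⟪f p, N p⟫ = ‖f p‖ := (sq_eq_sq₀ hpos.le (norm_nonneg _)).1 h1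
  refine ⟨h3 ▸ hpos, h3, ?_⟩
  rw [h3] at h2
  linarith

/-- If the Laplacian of `|f|²` is nonnegative, then `|f|` is constant. -/
theorem IsImmersedHypersurface.norm_eq_of_subharmonic [ConnectedSpace M]
    (h : IsImmersedHypersurface f N)
    (hsub : ∀ q, meanCurvature f N q * ⟪f q, N q⟫ ≤ n) {p : M} (hp : ∀ q, ‖f q‖ ≤ ‖f p‖) (q : M) :
    ‖f q‖ = ‖f p‖ := by
  have hclosed : IsClosed {q | ‖f q‖ = ‖f p‖} :=
    isClosed_eq h.smooth.continuous.norm continuous_const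
  have hopen : IsOpen {q | ‖f q‖ = ‖f p‖} := by
    rw [isOpen_iff_mem_nhds]
    intro q hq
    have hy := mem_extChartAt_target (I := 𝓡 n) q
    have hq' : (extChartAt (𝓡 n) q).symm (extChartAt (𝓡 n) q q) = q := extChartAt_to_inv q
    have hev := (h.isParametrized q).eventually_norm_eq (fun y hy => by
        have := hsub ((extChartAt (𝓡 n) q).symm y)
        rw [h.trace_inChart q hy]
        simp only [inChart, Function.comp_apply]
        linarith) (fun y _ => hp _) hy 
      (by simp only [inChart, Function.comp_apply, hq']; exact hq)
    have h2 := (continuousAt_extChartAt (I := 𝓡 n) q).eventually hev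
    filter_upwards [h2, extChartAt_source_mem_nhds (I := 𝓡 n) q] with z hz hzs
    simp only [inChart, Function.comp_apply] at hz
    rwa [(extChartAt (𝓡 n) q).left_inv hzs] at hz
  have := IsClopen.eq_univ ⟨hclosed, hopen⟩ ⟨p, rfl⟩
  exact Set.eq_univ_iff_forall.1 this q

end Charts

/-! ### Coverings of the sphere. -/

section CoveringSphere

/-- Stereographic projection identifies the punctured sphere with a vector space, which is simply
connected, so its inverse lifts to the covering. -/
theorem exists_section_compl_singleton {n : ℕ} {X : Type*} [TopologicalSpace X]
    {p : X → Metric.sphere (0 : Eucl (n + 1)) 1} (hp : IsCoveringMap p)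
    (v : Metric.sphere (0 : Eucl (n + 1)) 1) {e : X} (he : p e ≠ v) :
    ∃ s : Metric.sphere (0 : Eucl (n + 1)) 1 → X, ContinuousOn s {v}ᶜ ∧
      (∀ x ∈ ({v}ᶜ : Set (Metric.sphere (0 : Eucl (n + 1)) 1)), p (s x) = x) ∧ s (p e) = e := by
  have hv : ‖(v : Eucl (n + 1))‖ = 1 := by simp
  set φ := stereographic hv
  have hsrc : φ.source = {v}ᶜ := stereographic_source hv
  have htgt : φ.target = Set.univ := stereographic_target hv
  have hcont : Continuous φ.symm := by
    rw [← continuousOn_univ, ← htgt]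
    exact φ.continuousOn_symm
  have hes : p e ∈ φ.source := by rw [hsrc]; exact he
  obtain ⟨G, ⟨hG1, hG2⟩, -⟩ := hp.existsUnique_continuousMap_lifts ⟨φ.symm, hcont⟩ (φ (p e)) e
    (φ.left_inv hes).symm
  refine ⟨fun x => G (φ x), ?_, fun x hx => ?_, hG1⟩
  · rw [← hsrc]
    exact G.continuous.comp_continuousOn φ.continuousOn
  · exact (congrFun hG2 (φ x)).trans (φ.left_inv (hsrc ▸ hx))

/-- Stereographically, this is a vector space of dimension `n ≥ 2` minus one point. -/
theorem isConnected_compl_pair {n : ℕ} (hn : 2 ≤ n) (v : Metric.sphere (0 : Eucl (n + 1)) 1) :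
    IsConnected ({v}ᶜ ∩ {-v}ᶜ : Set (Metric.sphere (0 : Eucl (n + 1)) 1)) := by
  have hv : ‖(v : Eucl (n + 1))‖ = 1 := by simp
  set φ := stereographic hv
  have hsrc : φ.source = {v}ᶜ := stereographic_source hv
  have htgt : φ.target = Set.univ := stereographic_target hv
  have hcont : Continuous φ.symm := by
    rw [← continuousOn_univ, ← htgt]
    exact φ.continuousOn_symm
  have hrank : 1 < Module.rank ℝ (Submodule.span ℝ {(v : Eucl (n + 1))})ᗮ := by
    have : Fact (Module.finrank ℝ (Eucl (n + 1)) = n + 1) := ⟨by simp⟩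
    rw [← Module.finrank_eq_rank, Submodule.finrank_orthogonal_span_singleton (n := n)
      (ne_zero_of_mem_unit_sphere v)]
    exact_mod_cast hn
  have himg : φ.symm '' {φ (-v)}ᶜ = {v}ᶜ ∩ {-v}ᶜ := by
    have hneg : -v ∈ φ.source := by
      rw [hsrc]
      exact fun h => ne_neg_of_mem_unit_sphere ℝ v (Eq.symm h)
    ext x
    constructor
    · rintro ⟨w, hw, rfl⟩
      have hwt : w ∈ φ.target := htgt ▸ Set.mem_univ w
      refine ⟨hsrc ▸ φ.map_target hwt, fun h => hw ?_⟩
      rw [Set.mem_singleton_iff, ← φ.right_inv hwt]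
      exact congrArg φ h
    · rintro ⟨h1, h2⟩
      have hxs : x ∈ φ.source := hsrc ▸ h1
      exact ⟨φ x, fun h => h2 (φ.injOn hxs hneg h), φ.left_inv hxs⟩
  rw [← himg]
  exact (isConnected_compl_singleton_of_one_lt_rank hrank _).image _
    hcont.continuousOn

/-- A connected covering of a sphere of dimension at least two is one-to-one. -/
theorem injective_of_isCoveringMap_sphere {n : ℕ} (hn : 2 ≤ n) {X : Type*} [TopologicalSpace X]
    [PreconnectedSpace X] {p : X → Metric.sphere (0 : Eucl (n + 1)) 1} (hp : IsCoveringMap p)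
    (hsurj : Function.Surjective p) : Function.Injective p := by
  obtain ⟨v⟩ : Nonempty (Metric.sphere (0 : Eucl (n + 1)) 1) :=
    (NormedSpace.sphere_nonempty.2 zero_le_one).to_subtype
  obtain ⟨x₀, hx₀, hx₀'⟩ := (isConnected_compl_pair hn v).nonempty
  obtain ⟨e, rfl⟩ := hsurj x₀
  obtain ⟨s₁, hc₁, hp₁, he₁⟩ := exists_section_compl_singleton hp v hx₀
  obtain ⟨s₂, hc₂, hp₂, he₂⟩ := exists_section_compl_singleton hp (-v) hx₀'
  -- Both sections pass through `e`, so they agree on the connected overlap and glue to a global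
  -- section.
  have hagree : Set.EqOn s₁ s₂ ({v}ᶜ ∩ {-v}ᶜ) :=
    hp.eqOn_of_comp_eqOn (isConnected_compl_pair hn v).isPreconnected (hc₁.mono Set.inter_subset_left)
      (hc₂.mono Set.inter_subset_right)
      (fun x hx => (hp₁ x hx.1).trans (hp₂ x hx.2).symm) (a := p e) ⟨hx₀, hx₀'⟩
      (he₁.trans he₂.symm)
  classical
  set s : Metric.sphere (0 : Eucl (n + 1)) 1 → X := fun x => if x = v then s₂ x else s₁ x with hs
  have hs₁ : Set.EqOn s s₁ {v}ᶜ := fun x hx => if_neg hx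
  have hs₂ : Set.EqOn s s₂ {-v}ᶜ := fun x hx => by
    by_cases h : x = v
    · exact if_pos h
    · exact (hs₁ h).trans (hagree ⟨h, hx⟩)
  have hcov : ∀ x, x ∈ ({v}ᶜ : Set _) ∨ x ∈ ({-v}ᶜ : Set (Metric.sphere (0 : Eucl (n + 1)) 1)) := by
    intro x
    by_contra! h
    simp only [Set.mem_compl_iff, not_not, Set.mem_singleton_iff] at h
    exact ne_neg_of_mem_unit_sphere ℝ v (h.1.symm.trans h.2)
  have hsc : Continuous s := continuous_iff_continuousAt.2 fun x => by
    rcases hcov x with h | h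
    · exact (hc₁.congr hs₁).continuousAt (isOpen_compl_singleton.mem_nhds h)
    · exact (hc₂.congr hs₂).continuousAt (isOpen_compl_singleton.mem_nhds h)
  have hps : ∀ x, p (s x) = x := fun x => by
    rcases hcov x with h | h
    · rw [hs₁ h, hp₁ x h]
    · rw [hs₂ h, hp₂ x h]
  -- Both are lifts of `p` and agree at `e`; uniqueness of lifts on the connected space `X` makes
  -- `s` a left inverse.
  have hid : s ∘ p = id := hp.eq_of_comp_eq (hsc.comp hp.continuous) continuous_id
    (funext fun x => hps (p x)) e ((hs₁ hx₀).trans he₁)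
  exact Function.LeftInverse.injective (congrFun hid)

end CoveringSphere

/-! ### The cone over a hypersurface in a sphere. -/

section LocalSphere

variable {n : ℕ} {F N : Eucl n → Eucl (n + 1)} {U : Set (Eucl n)} {r : ℝ}

/-- Since `|F|` is constant, `F y` is orthogonal to the image of the derivative of `F`, so the cone
map has injective derivative between spaces of equal dimension. The inverse function theorem
applies, with no need for charts on the sphere. -/
theorem IsParametrizedHypersurface.exists_openPartialHomeomorph_cone
    (h : IsParametrizedHypersurface F N U) (hr : 0 < r) (hF : ∀ y ∈ U, ‖F y‖ = r) {y : Eucl n}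
    (hy : y ∈ U) : ∃ e : OpenPartialHomeomorph (Eucl n × ℝ) (Eucl (n + 1)),
      (y, 0) ∈ e.source ∧ ∀ z t, e (z, t) = (1 + t) • F z := by
  have hperp : ∀ w, ⟪F y, fderiv ℝ F y w⟫ = 0 := fun w => by
    have h1 : (fun y => ‖F y‖ ^ 2 / 2) =ᶠ[𝓝 y] fun _ => r ^ 2 / 2 :=
      eventually_of_mem (h.isOpen.mem_nhds hy) fun z hz => by simp only [hF z hz]
    have h2 := h1.fderiv_eq (𝕜 := ℝ)
    rw [(h.fderiv_half_norm_sq hy).fderiv] at h2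
    simpa using congrArg (fun L => L w) h2
  have hFs : HasStrictFDerivAt F (fderiv ℝ F y) y := (h.contDiffAt hy).hasStrictFDerivAt (by simp)
  have h1 : HasStrictFDerivAt (fun q : Eucl n × ℝ => F q.1)
      ((fderiv ℝ F y).comp (ContinuousLinearMap.fst ℝ _ _)) (y, 0) :=
    hFs.comp (y, (0 : ℝ)) hasStrictFDerivAt_fst
  have h2 : HasStrictFDerivAt (fun q : Eucl n × ℝ => 1 + q.2)
      (ContinuousLinearMap.snd ℝ (Eucl n) ℝ) (y, 0) :=
    HasStrictFDerivAt.const_add (1 : ℝ) (hasStrictFDerivAt_snd (𝕜 := ℝ))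
  have h3 := h2.smul h1
  set L : Eucl n × ℝ →L[ℝ] Eucl (n + 1) := (1 + (0 : ℝ)) •
    ((fderiv ℝ F y).comp (ContinuousLinearMap.fst ℝ (Eucl n) ℝ)) +
      (ContinuousLinearMap.snd ℝ (Eucl n) ℝ).smulRight (F y) with hL
  have hLapp : ∀ q, L q = fderiv ℝ F y q.1 + q.2 • F y := fun q => by simp [hL]
  have hinj : Function.Injective L := by
    refine (injective_iff_map_eq_zero L).2 fun q hq => ?_
    rw [hLapp] at hq
    have hq2 : q.2 = 0 := by
      have := congrArg (fun x => ⟪F y, x⟫) hq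
      simp only [inner_add_right, hperp, inner_smul_right, real_inner_self_eq_norm_sq, hF y hy,
        inner_zero_right, zero_add] at this
      exact (mul_eq_zero.1 this).resolve_right (by positivity)
    rw [hq2, zero_smul, add_zero] at hq
    exact Prod.ext (h.immersion y hy (hq.trans (map_zero _).symm)) hq2
  set e' : (Eucl n × ℝ) ≃L[ℝ] Eucl (n + 1) :=
    (LinearEquiv.ofInjectiveOfFinrankEq L.toLinearMap hinj (by simp)).toContinuousLinearEquiv
  have h4 : HasStrictFDerivAt (fun q : Eucl n × ℝ => (1 + q.2) • F q.1)
      (e' : Eucl n × ℝ →L[ℝ] Eucl (n + 1)) (y, 0) := h3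
  exact ⟨h4.toOpenPartialHomeomorph _, h4.mem_toOpenPartialHomeomorph_source, fun z t => rfl⟩

end LocalSphere

/-! ### Closed hypersurfaces contained in a sphere. -/

section Rigidity

variable {n : ℕ} {M : Type*} [TopologicalSpace M] [ChartedSpace (Eucl n) M]
  [IsManifold (𝓡 n) ∞ M] {f N : M → Eucl (n + 1)} {r : ℝ}

theorem IsImmersedHypersurface.exists_mem_nhds_injOn (h : IsImmersedHypersurface f N) (hr : 0 < r)
    (hf : ∀ q, ‖f q‖ = r) (p : M) : ∃ V ∈ 𝓝 p, Set.InjOn f V := by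
  obtain ⟨e, hes, he⟩ := (h.isParametrized p).exists_openPartialHomeomorph_cone hr
    (fun y _ => hf _) (mem_extChartAt_target (I := 𝓡 n) p)
  have hc : ContinuousAt (fun q => (extChartAt (𝓡 n) p q, (0 : ℝ))) p :=
    (continuousAt_extChartAt (I := 𝓡 n) p).prodMk continuousAt_const
  refine ⟨_, inter_mem (extChartAt_source_mem_nhds (I := 𝓡 n) p)
    (hc.preimage_mem_nhds (e.open_source.mem_nhds hes)), ?_⟩
  rintro a ⟨ha, ha'⟩ b ⟨hb, hb'⟩ hab
  have hval : ∀ c ∈ (extChartAt (𝓡 n) p).source, e (extChartAt (𝓡 n) p c, 0) = f c := fun c hc => by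
    rw [he, inChart, Function.comp_apply, (extChartAt (𝓡 n) p).left_inv hc, add_zero, one_smul]
  have := e.injOn ha' hb' (by rw [hval a ha, hval b hb, hab])
  exact (extChartAt (𝓡 n) p).injOn ha hb (congrArg Prod.fst this)

/-- The cone map is open, and a point `(1 + t) • F z` with `t > -1` lies on the sphere only for `t =
0`. -/
theorem IsImmersedHypersurface.image_mem_nhdsWithin_sphere (h : IsImmersedHypersurface f N)
    (hr : 0 < r) (hf : ∀ q, ‖f q‖ = r) {p : M} {V : Set M} (hV : V ∈ 𝓝 p) :
    f '' V ∈ 𝓝[Metric.sphere 0 r] (f p) := by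
  have hpt := mem_extChartAt_target (I := 𝓡 n) p
  obtain ⟨e, hes, he⟩ := (h.isParametrized p).exists_openPartialHomeomorph_cone hr
    (fun y _ => hf _) hpt
  have hsymm : (extChartAt (𝓡 n) p).symm (extChartAt (𝓡 n) p p) = p := extChartAt_to_inv p
  have hW : (extChartAt (𝓡 n) p).symm ⁻¹' V ∈ 𝓝 (extChartAt (𝓡 n) p p) :=
    (continuousAt_extChartAt_symm p).preimage_mem_nhds (by rwa [hsymm])
  have hep : e (extChartAt (𝓡 n) p p, 0) = f p := by
    rw [he, inChart, Function.comp_apply, hsymm, add_zero, one_smul]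
  have himg := e.image_mem_nhds hes
    (prod_mem_nhds hW (Ioo_mem_nhds (show (-1 : ℝ) < 0 by norm_num) zero_lt_one))
  rw [hep] at himg
  refine mem_of_superset (inter_mem (mem_nhdsWithin_of_mem_nhds himg) self_mem_nhdsWithin) ?_
  rintro _ ⟨⟨⟨z, t⟩, ⟨hz, ht⟩, rfl⟩, hs⟩
  refine ⟨(extChartAt (𝓡 n) p).symm z, hz, ?_⟩
  rw [he] at hs ⊢
  have h1 : 0 < 1 + t := by linarith [ht.1]
  rw [mem_sphere_zero_iff_norm, norm_smul, Real.norm_of_nonneg h1.le, inChart, Function.comp_apply,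
    hf] at hs
  have h2 : 1 + t = 1 := mul_right_cancel₀ hr.ne' (hs.trans (one_mul r).symm)
  rw [h2, one_smul]
  rfl

/-- A closed hypersurface lying on a sphere about the origin is that sphere. -/
theorem IsImmersedHypersurface.isRoundSphere [T2Space M] [CompactSpace M] [ConnectedSpace M]
    (h : IsImmersedHypersurface f N) (hn : 1 ≤ n) (hr : 0 < r) (hf : ∀ q, ‖f q‖ = r) :
    IsRoundSphere f r := by
  set g : M → Metric.sphere (0 : Eucl (n + 1)) 1 := fun q =>
    ⟨r⁻¹ • f q, by
      rw [mem_sphere_zero_iff_norm, norm_smul, hf, norm_inv, Real.norm_of_nonneg hr.le,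
        inv_mul_cancel₀ hr.ne']⟩ with hg
  have hgf : ∀ q, r • (g q : Eucl (n + 1)) = f q := fun q => by
    simp only [hg]; rw [smul_smul, mul_inv_cancel₀ hr.ne', one_smul]
  have hgc : Continuous g := (h.smooth.continuous.const_smul r⁻¹).subtype_mk _
  have hopen : IsOpenMap g := by
    refine IsOpenMap.of_nhds_le fun p V hV => ?_
    have h1 := h.image_mem_nhdsWithin_sphere hr hf (mem_map.1 hV)
    have hsc : Tendsto (fun x : Metric.sphere (0 : Eucl (n + 1)) 1 => r • (x : Eucl (n + 1)))
        (𝓝 (g p)) (𝓝[Metric.sphere 0 r] (f p)) := by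
      refine tendsto_nhdsWithin_iff.2 ⟨?_, Eventually.of_forall fun x => ?_⟩
      · rw [← hgf]
        exact ((continuous_subtype_val.const_smul r).tendsto _)
      · rw [mem_sphere_zero_iff_norm, norm_smul, Real.norm_of_nonneg hr.le]
        simp
    filter_upwards [hsc h1] with x hx
    obtain ⟨q, hq, hqx⟩ := hx
    have : g q = x := Subtype.ext (smul_right_injective _ hr.ne' ((hgf q).trans hqx))
    exact this ▸ hq
  have hloc : IsLocalHomeomorph g := by
    refine isLocalHomeomorph_iff_isOpenEmbedding_restrict.2 fun p => ?_
    obtain ⟨V, hV, hinj⟩ := h.exists_mem_nhds_injOn hr hf p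
    obtain ⟨W, hWV, hW, hpW⟩ := mem_nhds_iff.1 hV
    refine ⟨W, hW.mem_nhds hpW, ?_⟩
    refine .of_continuous_injective_isOpenMap (hgc.comp continuous_subtype_val)
      (Set.injOn_iff_injective.1 fun a ha b hb hab => hinj (hWV ha) (hWV hb) ?_)
      (hopen.comp hW.isOpenMap_subtype_val)
    rw [← hgf, ← hgf, hab]
  have hconn : PreconnectedSpace (Metric.sphere (0 : Eucl (n + 1)) 1) := by
    refine Subtype.preconnectedSpace (isPreconnected_sphere ?_ 0 1)
    rw [← Module.finrank_eq_rank]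
    simp
    omega
  -- The image is open, and closed by compactness; the sphere is connected because `n ≥ 1`.
  have hsurj : Function.Surjective g := by
    rw [← Set.range_eq_univ]
    exact IsClopen.eq_univ ⟨(isCompact_range hgc).isClosed, hopen.isOpen_range⟩
      (Set.range_nonempty g)
  refine ⟨Set.Subset.antisymm ?_ fun x hx => ?_, fun hn2 a b hab => ?_⟩
  · rintro _ ⟨q, rfl⟩
    simp [hf]
  · have hx' : ‖x‖ = r := by simpa using hx
    obtain ⟨q, hq⟩ := hsurj ⟨r⁻¹ • x, by
      rw [mem_sphere_zero_iff_norm, norm_smul, hx', norm_inv, Real.norm_of_nonneg hr.le,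
        inv_mul_cancel₀ hr.ne']⟩
    refine ⟨q, ?_⟩
    rw [← hgf, hq]
    simp [smul_smul, hr.ne']
  -- By compactness the local homeomorphism `g` is a covering.
  · refine injective_of_isCoveringMap_sphere hn2 (isLocalHomeomorph_iff_isCoveringMap.1 hloc) hsurj
      (Subtype.ext ?_)
    simp only [hg, hab]

end Rigidity

/-! ### The bound, its equality case and the gap theorem. -/

section MainResults

variable {n : ℕ} {M : Type*} [TopologicalSpace M] [ChartedSpace (Eucl n) M]
  {f N : M → Eucl (n + 1)} {lam : ℝ}

theorem IsClosedSelfExpander.exists_max (h : IsClosedSelfExpander f N lam) :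
    ∃ p, (∀ q, ‖f q‖ ≤ ‖f p‖) ∧ 0 < ‖f p‖ ∧ n / ‖f p‖ + ‖f p‖ / 2 ≤ lam := by
  have := h.manifold
  obtain ⟨p, hp, hpos⟩ := h.outward
  obtain ⟨h1, h2, h3⟩ := h.hypersurface.le_meanCurvature_mul_of_max hp hpos
  refine ⟨p, hp, h1, ?_⟩
  rw [h.expander, h2] at h3
  rw [← div_le_iff₀ h1] at h3
  linarith

theorem IsClosedSelfExpander.sqrt_le (h : IsClosedSelfExpander f N lam) : √(2 * n) ≤ lam := by
  obtain ⟨p, -, hr, hle⟩ := h.exists_max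
  refine le_trans ?_ hle
  set r := ‖f p‖
  refine Real.sqrt_le_iff.2 ⟨by positivity, ?_⟩
  -- AM-GM: `(a + b)² ≥ 4ab` with `a = n/r`, `b = r/2`.
  have h1 : n / r * (r / 2) = (n : ℝ) / 2 := by field_simp
  nlinarith [sq_nonneg (n / r - r / 2)]

theorem IsClosedSelfExpander.inner_le_norm (h : IsClosedSelfExpander f N lam) (q : M) :
    ⟪f q, N q⟫ ≤ ‖f q‖ := by
  simpa [h.hypersurface.norm_normal q] using real_inner_le_norm (f q) (N q)

theorem IsClosedSelfExpander.isRoundSphere_of_norm_eq (hn : 1 ≤ n)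
    (h : IsClosedSelfExpander f N lam) {r : ℝ} (hr : 0 < r) (hf : ∀ q, ‖f q‖ = r) :
    IsRoundSphere f r := by
  have := h.manifold
  have := h.t2
  have := h.compact
  have := h.connected
  exact h.hypersurface.isRoundSphere hn hr hf

theorem IsClosedSelfExpander.isRoundSphere_sqrt (hn : 1 ≤ n)
    (h : IsClosedSelfExpander f N √(2 * n)) : IsRoundSphere f √(2 * n) := by
  have := h.manifold
  have := h.connected
  have hn' : (0 : ℝ) < n := by exact_mod_cast hn
  have hR : 0 < √(2 * n : ℝ) := by positivity
  have hR2 : √(2 * n : ℝ) ^ 2 = 2 * n := Real.sq_sqrt (by positivity)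
  set R := √(2 * n : ℝ)
  obtain ⟨p, hp, hr, hle⟩ := h.exists_max
  have hpR : ‖f p‖ = R := by
    have h1 : n / ‖f p‖ * ‖f p‖ = n := div_mul_cancel₀ _ hr.ne'
    -- The inequality `n/ρ + ρ/2 ≤ R` multiplied by `2ρ`, with `2n = R²`.
    have h2 : (‖f p‖ - R) ^ 2 ≤ 0 := by nlinarith
    nlinarith [pow_eq_zero_iff (two_ne_zero) |>.1 (le_antisymm h2 (sq_nonneg _))]
  refine h.isRoundSphere_of_norm_eq hn hR fun q => ?_
  rw [← hpR]
  refine h.hypersurface.norm_eq_of_subharmonic (fun q => ?_) hp q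
  rw [h.expander]
  nlinarith [sq_nonneg (⟪f q, N q⟫ - R)]

theorem IsClosedSelfExpander.isRoundSphere_of_normSqA_le (hn : 1 ≤ n)
    (h : IsClosedSelfExpander f N lam)
    (hA : ∀ p, normSqA f N p ≤ -1 / 2 + lam * (lam - √(lam ^ 2 - 2 * n)) / (2 * n)) :
    IsRoundSphere f (lam + √(lam ^ 2 - 2 * n)) := by
  have hn' : (0 : ℝ) < n := by exact_mod_cast hn
  have hlam : 0 < lam := lt_of_lt_of_le (by positivity) h.sqrt_le
  have hlam2 : 2 * n ≤ lam ^ 2 := (Real.sqrt_le_left hlam.le).1 h.sqrt_le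
  set d := √(lam ^ 2 - 2 * n) with hd
  have hd0 : 0 ≤ d := Real.sqrt_nonneg _
  have hd2 : d ^ 2 = lam ^ 2 - 2 * n := Real.sq_sqrt (by linarith)
  have hr : 0 < lam + d := by linarith
  have hprod : (lam + d) * (lam - d) = 2 * n := by linear_combination -hd2
  have hquot : n / (lam + d) = (lam - d) / 2 := by
    rw [div_eq_iff hr.ne']
    linear_combination -hprod / 2
  -- The right-hand side is `|A|²` of the round sphere of radius `lam + d`.
  have hbound : -1 / 2 + lam * (lam - d) / (2 * n) = n / (lam + d) ^ 2 := by
    have hne : lam - d ≠ 0 := right_ne_zero_of_mul (hprod.trans_ne (by positivity))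
    have h1 : lam * (lam - d) / (2 * n) = lam / (lam + d) := by
      rw [← hprod]
      field_simp
    rw [h1, sq, ← div_div, hquot]
    field_simp
    ring
  obtain ⟨p, hp, hρ, hle⟩ := h.exists_max
  have hρr : ‖f p‖ ≤ lam + d := by
    have h1 : n / ‖f p‖ * ‖f p‖ = n := div_mul_cancel₀ _ hρ.ne'
    -- The farthest distance lies between the roots `lam ± d` of `ρ² - 2 lam ρ + 2n`.
    have h2 : (‖f p‖ - lam) ^ 2 ≤ d ^ 2 := by nlinarith
    linarith [(abs_le.1 (abs_le_of_sq_le_sq h2 hd0)).2]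
  refine h.isRoundSphere_of_norm_eq hn hr fun q => ?_
  refine le_antisymm ((hp q).trans hρr) (le_trans ?_ (h.inner_le_norm q))
  have hH : meanCurvature f N q ≤ n / (lam + d) := by
    refine (abs_le.1 (abs_le_of_sq_le_sq ?_ (by positivity))).2
    calc meanCurvature f N q ^ 2 ≤ n * normSqA f N q := h.hypersurface.sq_meanCurvature_le q
      _ ≤ n * (n / (lam + d) ^ 2) := by
        have := hA q
        rw [hbound] at this
        gcongr
      _ = (n / (lam + d)) ^ 2 := by rw [div_pow]; ring
  rw [h.expander, hquot] at hH
  linarith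

end MainResults

/-! ### The sphere of radius `√(2n)` as an example. -/

section Sphere

variable {n : ℕ}

theorem contMDiff_sphereNormal :
    ContMDiff (𝓡 n) 𝓘(ℝ, Eucl (n + 1)) ∞ (sphereNormal n) := by
  have : Fact (Module.finrank ℝ (Eucl (n + 1)) = n + 1) := ⟨by simp⟩
  exact contMDiff_coe_sphere

theorem mfderiv_sphereMap (r : ℝ) (p : Metric.sphere (0 : Eucl (n + 1)) 1) :
    (mfderiv (𝓡 n) 𝓘(ℝ, Eucl (n + 1)) (sphereMap n r) p : Eucl n →L[ℝ] Eucl (n + 1)) =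
      r • (mfderiv (𝓡 n) 𝓘(ℝ, Eucl (n + 1)) (sphereNormal n) p : Eucl n →L[ℝ] Eucl (n + 1)) :=
  const_smul_mfderiv (contMDiff_sphereNormal.mdifferentiableAt (by simp)) r

theorem partialAt_sphereMap (r : ℝ) (p : Metric.sphere (0 : Eucl (n + 1)) 1) (i : Fin n) :
    partialAt (sphereMap n r) p i = r • partialAt (sphereNormal n) p i :=
  congrArg (fun L : Eucl n →L[ℝ] Eucl (n + 1) => L (EuclideanSpace.single i 1))
    (mfderiv_sphereMap r p)

theorem inner_partialAt_sphereNormal (p : Metric.sphere (0 : Eucl (n + 1)) 1) (i : Fin n) :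
    ⟪(p : Eucl (n + 1)), partialAt (sphereNormal n) p i⟫ = 0 := by
  have : Fact (Module.finrank ℝ (Eucl (n + 1)) = n + 1) := ⟨by simp⟩
  have h := range_mvfderiv_subtypeVal (n := n) p
  have h1 : partialAt (sphereNormal n) p i ∈ (Submodule.span ℝ {(p : Eucl (n + 1))})ᗮ := by
    rw [← h]
    exact ⟨EuclideanSpace.single i 1, rfl⟩
  exact Submodule.mem_orthogonal_singleton_iff_inner_right.1 h1

theorem isImmersedHypersurface_sphereMap {r : ℝ} (hr : 0 < r) :
    IsImmersedHypersurface (sphereMap n r) (sphereNormal n) where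
  smooth := (contDiff_const_smul r).contMDiff.comp contMDiff_sphereNormal
  immersion p := by
    have : Fact (Module.finrank ℝ (Eucl (n + 1)) = n + 1) := ⟨by simp⟩
    have h := injective_mvfderiv_subtypeVal_sphere (n := n) p
    intro a b hab
    have ha : ∀ c, mfderiv (𝓡 n) 𝓘(ℝ, Eucl (n + 1)) (sphereMap n r) p c
        = r • (mvfderiv (𝓡 n) ((↑) : Metric.sphere (0 : Eucl (n + 1)) 1 → Eucl (n + 1)) p c) :=
      fun c => congrArg (fun L : Eucl n →L[ℝ] Eucl (n + 1) => L c) (mfderiv_sphereMap r p)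
    rw [ha, ha] at hab
    exact h (smul_right_injective _ hr.ne' hab)
  smooth_normal := contMDiff_sphereNormal
  norm_normal p := by simp [sphereNormal]
  normal p i := by
    rw [partialAt_sphereMap, inner_smul_right]
    exact mul_eq_zero_of_right _ (inner_partialAt_sphereNormal p i)

theorem meanCurvature_sphereMap {r : ℝ} (hr : 0 < r) (p : Metric.sphere (0 : Eucl (n + 1)) 1) :
    meanCurvature (sphereMap n r) (sphereNormal n) p = n / r := by
  have hu := ((isImmersedHypersurface_sphereMap (n := n) hr).posDef_gram p).det_pos.ne'.isUnit
  -- The normal is `r⁻¹` times the position, hence `A = -r⁻¹ • id`.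
  have hS : secondFF (sphereMap n r) (sphereNormal n) p = (-r⁻¹) • gram (sphereMap n r) p := by
    ext i j
    simp only [secondFF, gram, Matrix.smul_apply, Matrix.of_apply, partialAt_sphereMap,
      inner_smul_left, inner_smul_right, smul_eq_mul, RCLike.conj_to_real]
    field_simp
  rw [meanCurvature, hS, Matrix.mul_smul, Matrix.nonsing_inv_mul _ hu, Matrix.trace_smul,
    Matrix.trace_one]
  simp
  field_simp

theorem isClosedSelfExpander_sphereMap (hn : 1 ≤ n) :
    IsClosedSelfExpander (sphereMap n √(2 * n)) (sphereNormal n) √(2 * n) := by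
  have hn' : (0 : ℝ) < n := by exact_mod_cast hn
  have hR : 0 < √(2 * n : ℝ) := by positivity
  have hR2 : √(2 * n : ℝ) ^ 2 = 2 * n := Real.sq_sqrt (by positivity)
  have hinner : ∀ p : Metric.sphere (0 : Eucl (n + 1)) 1,
      ⟪sphereMap n √(2 * n) p, sphereNormal n p⟫ = √(2 * n) := fun p => by
    simp [sphereMap, sphereNormal, inner_smul_left]
  have hnorm : ∀ p : Metric.sphere (0 : Eucl (n + 1)) 1, ‖sphereMap n √(2 * n) p‖ = √(2 * n) :=
    fun p => by rw [sphereMap, norm_smul, norm_eq_of_mem_sphere, mul_one, Real.norm_of_nonneg hR.le]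
  have hconn : IsConnected (Metric.sphere (0 : Eucl (n + 1)) 1) := by
    refine isConnected_sphere ?_ 0 zero_le_one
    rw [← Module.finrank_eq_rank]
    simp
    omega
  obtain ⟨x, hx⟩ := hconn.nonempty
  exact
    { manifold := inferInstance
      t2 := inferInstance
      compact := inferInstance
      connected := Subtype.connectedSpace hconn
      hypersurface := isImmersedHypersurface_sphereMap hR
      outward := ⟨⟨x, hx⟩, fun q => by rw [hnorm, hnorm], by rwa [hinner]⟩
      expander := fun p => by
        rw [meanCurvature_sphereMap hR, hinner, div_eq_iff hR.ne']
        linear_combination -hR2 / 2 }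

end Sphere

end LambdaExpander

end

theorem theorem1p1 (n : ℕ) (hn : 1 ≤ n) :
    -- the lower bound for `lam`
    (∀ (M : Type*) [TopologicalSpace M] [ChartedSpace (LambdaExpander.Eucl n) M]
        (f N : M → LambdaExpander.Eucl (n + 1)) (lam : ℝ),
        LambdaExpander.IsClosedSelfExpander f N lam → Real.sqrt (2 * n) ≤ lam) ∧
    -- the sphere of radius `√(2n)` attains the bound
    LambdaExpander.IsClosedSelfExpander
      (LambdaExpander.sphereMap n (Real.sqrt (2 * n))) (LambdaExpander.sphereNormal n)
      (Real.sqrt (2 * n)) ∧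
    -- and nothing else does
    (∀ (M : Type*) [TopologicalSpace M] [ChartedSpace (LambdaExpander.Eucl n) M]
        (f N : M → LambdaExpander.Eucl (n + 1)),
        LambdaExpander.IsClosedSelfExpander f N (Real.sqrt (2 * n)) →
        LambdaExpander.IsRoundSphere f (Real.sqrt (2 * n))) ∧
    -- the gap theorem
    (∀ (M : Type*) [TopologicalSpace M] [ChartedSpace (LambdaExpander.Eucl n) M]
        (f N : M → LambdaExpander.Eucl (n + 1)) (lam : ℝ),
        LambdaExpander.IsClosedSelfExpander f N lam →
        (∀ p, LambdaExpander.normSqA f N p ≤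
          -1 / 2 + lam * (lam - Real.sqrt (lam ^ 2 - 2 * n)) / (2 * n)) →
        LambdaExpander.IsRoundSphere f (lam + Real.sqrt (lam ^ 2 - 2 * n))) :=
  ⟨fun _ _ _ _ _ _ h => h.sqrt_le,
    LambdaExpander.isClosedSelfExpander_sphereMap hn,
    fun _ _ _ _ _ h => h.isRoundSphere_sqrt hn,
    fun _ _ _ _ _ _ h hA => h.isRoundSphere_of_normSqA_le hn hA⟩
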